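/- Let $m>0$, $L\in\mathbb R$. There is a constant $\eta_0\in(0,1)$ depending only on $m$ and $L$ such that the following holds for every dimension $d$, every integer $K\ge 1$, every step size $\eta\in(0,\eta_0)$ and every differentiable $U:\mathbb R^d\to\mathbb R$ with $\nabla U(0)=0$ and $$\frac m2|x-y|^2\le U(y)-U(x)-\langle\nabla U(x),y-x\rangle\le\frac L2|x-y|^2\qquad(x,y\in\mathbb R^d).$$ Consider the Poisson Randomized Midpoint Langevin Monte Carlo (PRLMC) chain $$\tilde X_{k+1}=\tilde X_k-\eta\nabla U(\tilde X_k)+\eta\sum_{i=0}^{K-1}H_{k,i}\big(\nabla U(\tilde X_k)-\nabla U(\hat X_{k,i})\big)+\sqrt{2\eta}\,\xi_{k+1},$$ $$\hat X_{k,i}=\tilde X_k-\frac{i\eta}{K}\nabla U(\tilde X_k)+\sqrt{\frac{2i\eta}{K}}\,\zeta_{k,i}\qquad(k\ge0,\ 0\le i\le K-1),$$ where all the $H_{k,i}$, $\zeta_{k,i}$, $\xi_{k+1}$ are independent, the $H_{k,i}$ are Bernoulli with parameter $1/K$, and the $\zeta_{k,i}$ and $\xi_{k+1}$ are standard Gaussian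 in $\mathbb R^d$. This Markov chain has a unique stationary distribution $\pi_\eta$ (a Borel probability measure invariant under its one-step transition kernel). The measure $\pi_\eta$ has a finite second moment, and $$\int_{\mathbb R^d}|x|^2\,\pi_\eta(\mathrm dx)\le\frac dm\Big\{2+4\eta^2L^2\big(2-\tfrac1K\big)+L^2\big(1-\tfrac1K\big)\Big\}.$$ Furthermore, there is $\delta>1$, which does not depend on the starting point, such that for every deterministic starting point $\tilde X_0=x\in\mathbb R^d$ $$\sum_{n=1}^\infty\delta^n\,d_{\rm TV}(\mathcal L(\tilde X_n),\pi_\eta)<\infty,$$ and hence $d_{\rm TV}(\mathcal L(\tilde X_n),\pi_\eta)=o(\delta^{-n})$ as $n\to\infty$. Here $\mathcal L(\tilde X_n)$ is the law of $\tilde X_n$ and $d_{\rm TV}(\mu,\nu)=\sup_{A}|\mu(A)-\nu(A)|$ over Borel sets $A\subset\mathbb R^d$. -/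

import Mathlib

open MeasureTheory ProbabilityTheory Filter Asymptotics

noncomputable section

namespace PRLMC

/-- The standing assumption on the potential `U` on `ℝ^d`: `U` is differentiable, `m`-strongly
convex and `L`-gradient-Lipschitz in the form of the two-sided quadratic bound, and its gradient
vanishes at the origin. -/
structure IsPotential {d : ℕ} (m L : ℝ) (U : EuclideanSpace ℝ (Fin d) → ℝ) : Prop where
  differentiable : Differentiable ℝ U
  lower_bound : ∀ x y, m / 2 * ‖x - y‖ ^ 2 ≤ U y - U x - inner ℝ (gradient U x) (y - x)
  upper_bound : ∀ x y, U y - U x - inner ℝ (gradient U x) (y - x) ≤ L / 2 * ‖x - y‖ ^ 2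
  gradient_zero : gradient U 0 = 0

/-- The randomness `(H, ζ, ξ)` used in one step: the midpoint selectors `H₀, …, H_{K-1}`, the
Gaussian vectors `ζ₀, …, ζ_{K-1}` driving the midpoints, and the Gaussian vector `ξ` driving the
step itself. -/
abbrev Noise (d K : ℕ) : Type :=
  (Fin K → ℝ) × (Fin K → EuclideanSpace ℝ (Fin d)) × EuclideanSpace ℝ (Fin d)

/-- `1 / K` as an element of the unit interval. -/
def invNat (K : ℕ) : unitInterval :=
  ⟨1 / (K : ℝ), by positivity, by simpa using Nat.cast_inv_le_one K⟩

/-- The law of the randomness of one step: all components are independent, the `H i` are Bernoulli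
(values `1` and `0`) with parameter `1 / K`, and the other components are standard Gaussian. -/
def noiseLaw (d K : ℕ) : Measure (Noise d K) :=
  (Measure.pi fun _ => bernoulliMeasure (1 : ℝ) 0 (invNat K)).prod
    ((Measure.pi fun _ => stdGaussian (EuclideanSpace ℝ (Fin d))).prod
      (stdGaussian (EuclideanSpace ℝ (Fin d))))

/-- The `i`-th midpoint
`x - (i η / K) ∇U(x) + √(2 i η / K) z`. -/
def midpoint {d : ℕ} (U : EuclideanSpace ℝ (Fin d) → ℝ) (η : ℝ) (K i : ℕ)
    (x z : EuclideanSpace ℝ (Fin d)) : EuclideanSpace ℝ (Fin d) :=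
  x - (i * η / K) • gradient U x + √(2 * i * η / K) • z

/-- One step of the algorithm from `x` with randomness `w = (H, ζ, ξ)`:
`x - η ∇U(x) + η ∑ᵢ Hᵢ (∇U(x) - ∇U(x̂ᵢ)) + √(2η) ξ`. -/
def step {d : ℕ} (U : EuclideanSpace ℝ (Fin d) → ℝ) (η : ℝ) (K : ℕ)
    (x : EuclideanSpace ℝ (Fin d)) (w : Noise d K) : EuclideanSpace ℝ (Fin d) :=
  x - η • gradient U x
    + η • ∑ i : Fin K, w.1 i • (gradient U x - gradient U (midpoint U η K i x (w.2.1 i)))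
    + √(2 * η) • w.2.2

theorem measurable_gradient {d : ℕ} (U : EuclideanSpace ℝ (Fin d) → ℝ) :
    Measurable (gradient U) :=
  (InnerProductSpace.toDual ℝ (EuclideanSpace ℝ (Fin d))).symm.continuous.measurable.comp
    (measurable_fderiv ℝ U)

theorem measurable_step {d : ℕ} (U : EuclideanSpace ℝ (Fin d) → ℝ) (η : ℝ) (K : ℕ) :
    Measurable fun p : EuclideanSpace ℝ (Fin d) × Noise d K => step U η K p.1 p.2 := by
  have hg := measurable_gradient U
  unfold step midpoint
  fun_prop

theorem measurable_step_right {d : ℕ} (U : EuclideanSpace ℝ (Fin d) → ℝ) (η : ℝ) (K : ℕ)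
    (x : EuclideanSpace ℝ (Fin d)) : Measurable (step U η K x) := by
  have hg := measurable_gradient U
  unfold step midpoint
  fun_prop

instance (d K : ℕ) : IsProbabilityMeasure (noiseLaw d K) := by
  unfold noiseLaw; infer_instance

/-- The one-step transition kernel: `kernel U η K x` is the law of one step started at `x`. -/
def kernel {d : ℕ} (U : EuclideanSpace ℝ (Fin d) → ℝ) (η : ℝ) (K : ℕ) :
    Kernel (EuclideanSpace ℝ (Fin d)) (EuclideanSpace ℝ (Fin d)) where
  toFun x := (noiseLaw d K).map (step U η K x)
  measurable' := by
    refine Measure.measurable_of_measurable_coe _ fun A hA => ?_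
    have h : (fun x => ((noiseLaw d K).map (step U η K x)) A)
        = fun x => noiseLaw d K (Prod.mk x ⁻¹'
          ((fun p : EuclideanSpace ℝ (Fin d) × Noise d K => step U η K p.1 p.2) ⁻¹' A)) :=
      funext fun x => Measure.map_apply (measurable_step_right U η K x) hA
    rw [h]
    exact measurable_measure_prodMk_left (measurable_step U η K hA)

/-- `X` is the chain with potential `U`, step size `η` and parameter `K`, started at `x` and
driven by the randomness `W` on the probability space `(Ω, P)`: the `W k` are independent, each
with the one-step noise law, and `X` follows the recursion. -/
structure IsChain {d : ℕ} (U : EuclideanSpace ℝ (Fin d) → ℝ) (η : ℝ) (K : ℕ)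
    (x : EuclideanSpace ℝ (Fin d)) {Ω : Type*} [MeasurableSpace Ω] (P : Measure Ω)
    (W : ℕ → Ω → Noise d K) (X : ℕ → Ω → EuclideanSpace ℝ (Fin d)) : Prop where
  measurable_noise : ∀ k, Measurable (W k)
  law_noise : ∀ k, P.map (W k) = noiseLaw d K
  indep_noise : iIndepFun W P
  init : ∀ ω, X 0 ω = x
  step_eq : ∀ k ω, X (k + 1) ω = step U η K (X k ω) (W k ω)

/-- Total variation distance `sup_A |μ(A) - ν(A)|` over measurable sets `A` (for probability
measures). -/
def dTV {E : Type*} [MeasurableSpace E] (μ ν : Measure E) : ℝ :=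
  ⨆ A : {A : Set E // MeasurableSet A}, |μ.real A - ν.real A|

end PRLMC

end

/-!
The chain converges because a single step has two properties with respect to the Euclidean distance.

*Contraction.* Run two copies of the step with the same selectors, midpoint noise and Gaussian
increment. The factor `1 / K` in the law of the selectors makes the correction term replace, in
expectation, the gradient at the current state by the average of the gradients at the midpoints. To
first order in `η` the squared distance of the two copies therefore changes by `-2 η` times the
average of `⟪x - y, ∇U(x̂ᵢ) - ∇U(ŷᵢ)⟫`, and this is at least `m ‖x - y‖ ^ 2` up to `O(η)`, since
`x̂ᵢ - ŷᵢ` differs from `x - y` by `O(η)`. All errors are of order `η ^ 2` with constants that depend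
only on `m` and `L`, so for small `η` the mean square distance shrinks by the factor `1 - η m`
(`lintegral_norm_step_sub_sq_le`). In dual form, with `ρ = √(1 - η m)`, the kernel maps
`c`-Lipschitz functions to `c ρ`-Lipschitz functions.

*Smoothing.* Conditionally on the selectors and the midpoints, a step adds a Gaussian vector with
covariance `2 η I`. Shifting a Gaussian measure by `v` changes it by `O(‖v‖)` in total variation
(`abs_integral_stdGaussian_smul_sub_le`), so the kernel maps indicator functions to functions that
are Lipschitz with a constant `C` (`abs_integral_kernel_sub_le`).

Together, `x ↦ κ ^ (n + 1) (x, A)` is `C ρ ^ n`-Lipschitz for every measurable set `A`, uniformly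
in `A`. The rest is formal (`IsContractiveSmoothing`). The laws of the chain started at the origin
are Cauchy uniformly over measurable sets, and their limit is an invariant probability measure `π`.
Integrating the Lipschitz bound against an invariant measure gives uniqueness, and the rate
`C ρ ^ n ∫ ‖x - y‖ π(dy)` in total variation from the starting point `x`.

The second moment bound comes from the drift inequality
`E ‖X₁‖ ^ 2 ≤ (1 - η m) ‖x‖ ^ 2 + η m B` (`lintegral_norm_step_sq_le`), where `B` is the asserted
bound: started at the origin, the chain has second moment at most `B` at all times, and this passes
to `π` by lower semicontinuity.
-/

namespace PRLMC

/-! ### Monotonicity and Lipschitz continuity of the gradient -/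

section Gradient

variable {d : ℕ} {m L : ℝ} {U : EuclideanSpace ℝ (Fin d) → ℝ}

theorem IsPotential.inner_gradient_sub_ge (hU : IsPotential m L U) (x y : EuclideanSpace ℝ (Fin d)) :
    m * ‖x - y‖ ^ 2 ≤ inner ℝ (x - y) (gradient U x - gradient U y) := by
  have h1 := hU.lower_bound x y
  have h2 := hU.lower_bound y x
  rw [norm_sub_rev y x] at h2
  have h3 : inner ℝ (x - y) (gradient U x - gradient U y)
      = - inner ℝ (gradient U x) (y - x) - inner ℝ (gradient U y) (x - y) := by
    rw [real_inner_comm, inner_sub_left, ← neg_sub x y, inner_neg_right]; ring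
  linarith

/-- Convexity together with the quadratic upper bound gives cocoercivity of the gradient. -/
theorem IsPotential.norm_gradient_sub_sq_le (hm : 0 ≤ m) (hL : 0 < L) (hU : IsPotential m L U)
    (x y : EuclideanSpace ℝ (Fin d)) :
    ‖gradient U x - gradient U y‖ ^ 2 ≤ L * inner ℝ (x - y) (gradient U x - gradient U y) := by
  -- the quadratic upper bound is used at the point that minimises it
  have key : ∀ x y : EuclideanSpace ℝ (Fin d),
      U x + inner ℝ (gradient U x) (y - x) + 1 / (2 * L) * ‖gradient U y - gradient U x‖ ^ 2
        ≤ U y := by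
    intro x y
    set w := gradient U y - gradient U x with hw
    have h1 := hU.lower_bound x (y - (1 / L) • w)
    have h2 := hU.upper_bound y (y - (1 / L) • w)
    have h3 : 0 ≤ m / 2 * ‖x - (y - (1 / L) • w)‖ ^ 2 := by positivity
    have e1 : y - (1 / L) • w - x = (y - x) - (1 / L) • w := by abel
    have e2 : y - (1 / L) • w - y = - ((1 / L) • w) := by abel
    have e3 : y - (y - (1 / L) • w) = (1 / L) • w := by abel
    rw [e1, inner_sub_right, inner_smul_right] at h1
    rw [e2, e3, inner_neg_right, inner_smul_right, norm_smul, mul_pow, Real.norm_eq_abs,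
      sq_abs] at h2
    have e4 : inner ℝ (gradient U y) w - inner ℝ (gradient U x) w = ‖w‖ ^ 2 := by
      rw [← inner_sub_left, ← hw, real_inner_self_eq_norm_sq]
    have e5 : L / 2 * ((1 / L) ^ 2 * ‖w‖ ^ 2) = 1 / (2 * L) * ‖w‖ ^ 2 := by
      field_simp
    have e6 : 1 / L * inner ℝ (gradient U y) w - 1 / L * inner ℝ (gradient U x) w
        = 2 * (1 / (2 * L) * ‖w‖ ^ 2) := by
      rw [← mul_sub, e4]; field_simp
    linarith
  have h1 := key x y
  have h2 := key y x
  rw [norm_sub_rev] at h1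
  have h3 : inner ℝ (x - y) (gradient U x - gradient U y)
      = - inner ℝ (gradient U x) (y - x) - inner ℝ (gradient U y) (x - y) := by
    rw [real_inner_comm, inner_sub_left, ← neg_sub x y, inner_neg_right]; ring
  have h4 : L * (2 * (1 / (2 * L) * ‖gradient U x - gradient U y‖ ^ 2))
      = ‖gradient U x - gradient U y‖ ^ 2 := by field_simp
  rw [← h4]
  exact mul_le_mul_of_nonneg_left (by linarith) hL.le

/-- The bound is stated with `|L|` because `L` may be negative when `d = 0`. -/
theorem IsPotential.norm_gradient_sub_le (hm : 0 < m) (hU : IsPotential m L U)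
    (x y : EuclideanSpace ℝ (Fin d)) :
    ‖gradient U x - gradient U y‖ ≤ |L| * ‖x - y‖ := by
  rcases eq_or_ne x y with rfl | hxy
  · simp
  have hpos : 0 < ‖x - y‖ := norm_pos_iff.2 (sub_ne_zero.2 hxy)
  have hL : 0 < L := by
    have := (hU.lower_bound x y).trans (hU.upper_bound x y)
    have := le_of_mul_le_mul_right this (by positivity)
    linarith
  rw [abs_of_pos hL]
  have h1 := hU.norm_gradient_sub_sq_le hm.le hL x y
  have h2 := real_inner_le_norm (x - y) (gradient U x - gradient U y)
  by_contra! h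
  have h0 : 0 < ‖gradient U x - gradient U y‖ := lt_of_le_of_lt (by positivity) h
  nlinarith

end Gradient

/-! ### Total variation distance of shifted Gaussian measures -/

section GaussianShift

theorem gaussianPDFReal_eq_exp_mul (u x : ℝ) :
    gaussianPDFReal u 1 x = gaussianPDFReal 0 1 x * Real.exp (u * x - u ^ 2 / 2) := by
  simp only [gaussianPDFReal, mul_assoc, ← Real.exp_add]
  congr 2
  simp
  ring

theorem integral_gaussianReal_add (h : ℝ → ℝ) (hh : Measurable h) (u : ℝ) :
    ∫ t, h (t + u) ∂gaussianReal 0 1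
      = ∫ t, Real.exp (u * t - u ^ 2 / 2) * h t ∂gaussianReal 0 1 := by
  have h1 : ∫ t, h (t + u) ∂gaussianReal 0 1 = ∫ t, h t ∂gaussianReal u 1 := by
    have := gaussianReal_map_add_const (μ := 0) (v := 1) u
    rw [zero_add] at this
    rw [← this, integral_map (by fun_prop) hh.aestronglyMeasurable]
  rw [h1, integral_gaussianReal_eq_integral_smul one_ne_zero,
    integral_gaussianReal_eq_integral_smul one_ne_zero]
  simp_rw [gaussianPDFReal_eq_exp_mul u, smul_eq_mul, mul_assoc]

theorem integrable_exp_mul_sub_gaussianReal (a b : ℝ) :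
    Integrable (fun t => Real.exp (a * t - b)) (gaussianReal 0 1) := by
  simp_rw [Real.exp_sub]
  exact (integrable_exp_mul_gaussianReal a).div_const _

theorem integral_exp_mul_sub_gaussianReal (a b : ℝ) :
    ∫ t, Real.exp (a * t - b) ∂gaussianReal 0 1 = Real.exp (a ^ 2 / 2 - b) := by
  have h := congrFun (mgf_fun_id_gaussianReal (μ := 0) (v := 1)) a
  simp only [mgf] at h
  simp_rw [Real.exp_sub, integral_div]
  rw [h]
  simp

/-- The `L¹` distance between the density of a shifted Gaussian and `1`, bounded by its `L²` distance
`√(exp (u ^ 2) - 1)`. -/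
theorem integral_abs_exp_sub_one_gaussianReal_le (u : ℝ) (hu : |u| ≤ 1) :
    ∫ t, |Real.exp (u * t - u ^ 2 / 2) - 1| ∂gaussianReal 0 1 ≤ 2 * |u| := by
  have e : ∀ t, |Real.exp (u * t - u ^ 2 / 2) - 1| ^ 2
      = Real.exp (2 * u * t - u ^ 2) - 2 * Real.exp (u * t - u ^ 2 / 2) + 1 := by
    intro t
    rw [sq_abs, sub_sq, ← Real.exp_nat_mul]
    push_cast
    ring_nf
  have i1 := integrable_exp_mul_sub_gaussianReal (2 * u) (u ^ 2)
  have i2 := integrable_exp_mul_sub_gaussianReal u (u ^ 2 / 2)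
  have hsq : ∫ t, |Real.exp (u * t - u ^ 2 / 2) - 1| ^ 2 ∂gaussianReal 0 1
      = Real.exp (u ^ 2) - 1 := by
    simp_rw [e]
    rw [integral_add (f := fun t => Real.exp (2 * u * t - u ^ 2)
        - 2 * Real.exp (u * t - u ^ 2 / 2)) (i1.sub (i2.const_mul 2)) (integrable_const _),
      integral_sub i1 (i2.const_mul 2), integral_const_mul,
      integral_exp_mul_sub_gaussianReal, integral_exp_mul_sub_gaussianReal]
    simp
    ring_nf
  have isq : Integrable (fun t => |Real.exp (u * t - u ^ 2 / 2) - 1| ^ 2) (gaussianReal 0 1) := by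
    simp_rw [e]
    exact (i1.sub (i2.const_mul 2)).add (integrable_const _)
  have hmem : MemLp (fun t => |Real.exp (u * t - u ^ 2 / 2) - 1|) 2 (gaussianReal 0 1) :=
    (memLp_two_iff_integrable_sq (by fun_prop)).2 isq
  have hvar := variance_nonneg (fun t => |Real.exp (u * t - u ^ 2 / 2) - 1|) (gaussianReal 0 1)
  rw [variance_eq_sub hmem] at hvar
  simp only [Pi.pow_apply, hsq] at hvar
  have hexp : Real.exp (u ^ 2) ≤ 1 + 2 * u ^ 2 := by
    have h1 : |u ^ 2| ≤ 1 := by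
      rw [abs_of_nonneg (sq_nonneg u), ← sq_abs]
      exact pow_le_one₀ (abs_nonneg u) hu
    have := (abs_le.1 (Real.abs_exp_sub_one_le h1)).2
    rw [abs_of_nonneg (sq_nonneg u)] at this
    linarith
  refine abs_le_of_sq_le_sq' ?_ (by positivity) |>.2
  rw [mul_pow, sq_abs]
  nlinarith [sq_nonneg u]

theorem abs_integral_gaussianReal_add_sub_le {h : ℝ → ℝ} (hh : Measurable h)
    (h0 : ∀ t, 0 ≤ h t) (h1 : ∀ t, h t ≤ 1) (u : ℝ) :
    |∫ t, h (t + u) ∂gaussianReal 0 1 - ∫ t, h t ∂gaussianReal 0 1| ≤ 2 * |u| := by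
  have hb : ∀ t, ‖h t‖ ≤ 1 := fun t => by rw [Real.norm_of_nonneg (h0 t)]; exact h1 t
  have ih : Integrable h (gaussianReal 0 1) :=
    Integrable.of_bound hh.aestronglyMeasurable 1 (ae_of_all _ hb)
  rcases le_total |u| 1 with hu | hu
  · have i2 := integrable_exp_mul_sub_gaussianReal u (u ^ 2 / 2)
    have i3 : Integrable (fun t => Real.exp (u * t - u ^ 2 / 2) * h t) (gaussianReal 0 1) :=
      i2.mul_bdd hh.aestronglyMeasurable (ae_of_all _ hb)
    rw [integral_gaussianReal_add h hh, ← integral_sub i3 ih]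
    rw [← Real.norm_eq_abs]
    refine (norm_integral_le_integral_norm _).trans
      (le_trans ?_ (integral_abs_exp_sub_one_gaussianReal_le u hu))
    refine integral_mono (i3.sub ih).norm (i2.sub (integrable_const _)).norm fun t => ?_
    have : Real.exp (u * t - u ^ 2 / 2) * h t - h t = (Real.exp (u * t - u ^ 2 / 2) - 1) * h t := by
      ring
    simp only [this, norm_mul]
    exact mul_le_of_le_one_right (norm_nonneg _) (hb t)
  -- for `1 ≤ |u|` the trivial bound is enough, as both integrals lie in `[0, 1]`
  · have ih' : ∀ g : ℝ → ℝ, Measurable g → (∀ t, 0 ≤ g t) → (∀ t, g t ≤ 1) →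
        0 ≤ ∫ t, g t ∂gaussianReal 0 1 ∧ ∫ t, g t ∂gaussianReal 0 1 ≤ 1 := by
      intro g hg g0 g1
      refine ⟨integral_nonneg g0, ?_⟩
      refine (integral_mono (Integrable.of_bound hg.aestronglyMeasurable 1 (ae_of_all _ fun t => ?_))
        (integrable_const 1) g1).trans (by simp)
      rw [Real.norm_of_nonneg (g0 t)]; exact g1 t
    have a := ih' h hh h0 h1
    have b := ih' (fun t => h (t + u)) (by fun_prop) (fun t => h0 _) (fun t => h1 _)
    rw [abs_le]
    constructor <;> linarith [a.1, a.2, b.1, b.2]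

variable {E : Type*} [NormedAddCommGroup E] [InnerProductSpace ℝ E] [FiniteDimensional ℝ E]
  [MeasurableSpace E] [BorelSpace E]

/-- Resampling the component of a standard Gaussian vector along a unit vector `e` does not change
its law. -/
theorem map_prod_stdGaussian_gaussianReal {e : E} (he : ‖e‖ = 1) :
    ((stdGaussian E).prod (gaussianReal 0 1)).map
      (fun p : E × ℝ => p.1 - (inner ℝ e p.1) • e + p.2 • e) = stdGaussian E := by
  have hmeas : Measurable (fun p : E × ℝ => p.1 - (inner ℝ e p.1) • e + p.2 • e) := by fun_prop
  have : IsProbabilityMeasure (((stdGaussian E).prod (gaussianReal 0 1)).map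
      (fun p : E × ℝ => p.1 - (inner ℝ e p.1) • e + p.2 • e)) :=
    Measure.isProbabilityMeasure_map hmeas.aemeasurable
  refine Measure.ext_of_charFun ?_
  ext s
  rw [charFun_apply, integral_map hmeas.aemeasurable (by fun_prop)]
  have hsplit : ∀ p : E × ℝ,
      Complex.exp (inner ℝ (p.1 - (inner ℝ e p.1) • e + p.2 • e) s * Complex.I)
      = Complex.exp (inner ℝ p.1 (s - (inner ℝ e s) • e) * Complex.I)
        * Complex.exp ((inner ℝ e s : ℝ) * p.2 * Complex.I) := by
    intro p
    rw [← Complex.exp_add, ← add_mul]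
    congr 2
    rw [inner_add_left, inner_sub_left, inner_sub_right, inner_smul_left, inner_smul_left,
      inner_smul_right, real_inner_comm p.1 e]
    simp
    ring
  simp_rw [hsplit]
  rw [integral_prod_mul (fun z : E => Complex.exp (inner ℝ z (s - (inner ℝ e s) • e) * Complex.I))
      (fun t : ℝ => Complex.exp ((inner ℝ e s : ℝ) * t * Complex.I)),
    ← charFun_apply, ← charFun_apply_real, charFun_stdGaussian, charFun_gaussianReal,
    charFun_stdGaussian, ← Complex.exp_add]
  congr 1
  have hn : ‖s - (inner ℝ e s) • e‖ ^ 2 = ‖s‖ ^ 2 - (inner ℝ e s) ^ 2 := by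
    rw [norm_sub_sq_real, inner_smul_right, real_inner_comm, norm_smul, he, Real.norm_eq_abs,
      mul_one, sq_abs]
    ring
  rw [← Complex.ofReal_pow, hn]
  push_cast
  ring

/-- The one-dimensional bound applied to the component along `v`, with the other components
fixed. -/
theorem abs_integral_stdGaussian_add_sub_le {h : E → ℝ} (hh : Measurable h)
    (h0 : ∀ z, 0 ≤ h z) (h1 : ∀ z, h z ≤ 1) (v : E) :
    |∫ z, h (z + v) ∂stdGaussian E - ∫ z, h z ∂stdGaussian E| ≤ 2 * ‖v‖ := by
  rcases eq_or_ne v 0 with rfl | hv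
  · simp
  set e : E := (‖v‖⁻¹ : ℝ) • v with he_def
  have he : ‖e‖ = 1 := by
    rw [he_def, norm_smul, norm_inv, norm_norm, inv_mul_cancel₀ (norm_ne_zero_iff.2 hv)]
  have hve : v = ‖v‖ • e := by
    rw [he_def, smul_smul, mul_inv_cancel₀ (norm_ne_zero_iff.2 hv), one_smul]
  have hmeas : Measurable (fun p : E × ℝ => p.1 - (inner ℝ e p.1) • e + p.2 • e) := by fun_prop
  have key : ∀ g : E → ℝ, Measurable g → (∀ z, 0 ≤ g z) → (∀ z, g z ≤ 1) →
      Integrable (fun p : E × ℝ => g (p.1 - (inner ℝ e p.1) • e + p.2 • e))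
        ((stdGaussian E).prod (gaussianReal 0 1)) := fun g hg g0 g1 =>
    Integrable.of_bound (hg.comp hmeas).aestronglyMeasurable 1 (ae_of_all _ fun p => by
      rw [Real.norm_of_nonneg (g0 _)]; exact g1 _)
  have hi := key h hh h0 h1
  have hi' := key (fun z => h (z + v)) (by fun_prop) (fun z => h0 _) (fun z => h1 _)
  rw [← map_prod_stdGaussian_gaussianReal he,
    integral_map hmeas.aemeasurable (Measurable.aestronglyMeasurable (by fun_prop)),
    integral_map hmeas.aemeasurable hh.aestronglyMeasurable,
    integral_prod _ hi, integral_prod _ hi', ← integral_sub hi'.integral_prod_left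
      hi.integral_prod_left]
  rw [← Real.norm_eq_abs]
  refine (norm_integral_le_of_norm_le_const (C := 2 * ‖v‖) (ae_of_all _ fun z => ?_)).trans
    (by simp)
  have := abs_integral_gaussianReal_add_sub_le (h := fun t => h (z - (inner ℝ e z) • e + t • e))
    (by fun_prop) (fun t => h0 _) (fun t => h1 _) ‖v‖
  rw [abs_norm] at this
  simp only [add_smul, ← hve, ← add_assoc] at this
  exact this

theorem abs_integral_stdGaussian_smul_sub_le {h : E → ℝ} (hh : Measurable h)
    (h0 : ∀ z, 0 ≤ h z) (h1 : ∀ z, h z ≤ 1) {s : ℝ} (hs : 0 < s) (a b : E) :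
    |∫ z, h (a + s • z) ∂stdGaussian E - ∫ z, h (b + s • z) ∂stdGaussian E|
      ≤ 2 / s * ‖a - b‖ := by
  have := abs_integral_stdGaussian_add_sub_le (h := fun z => h (b + s • z)) (by fun_prop)
    (fun z => h0 _) (fun z => h1 _) (s⁻¹ • (a - b))
  rw [norm_smul, norm_inv, Real.norm_of_nonneg hs.le] at this
  convert this using 1
  · congr 4
    ext z
    rw [smul_add, smul_smul, mul_inv_cancel₀ hs.ne', one_smul]
    congr 1; abel
  · field_simp

end GaussianShift

/-! ### Second moment of the standard Gaussian measure -/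

section GaussianMoments

variable {E : Type*} [NormedAddCommGroup E] [InnerProductSpace ℝ E] [FiniteDimensional ℝ E]
  [MeasurableSpace E] [BorelSpace E]

theorem integrable_norm_sq_stdGaussian : Integrable (fun z : E => ‖z‖ ^ 2) (stdGaussian E) :=
  (IsGaussian.memLp_two_id (μ := stdGaussian E)).integrable_norm_pow (by norm_num)

theorem integral_inner_stdGaussian (v : E) : ∫ z, inner ℝ v z ∂stdGaussian E = 0 :=
  integral_strongDual_stdGaussian (innerSL ℝ v)

theorem integral_norm_sq_stdGaussian :
    ∫ z, ‖z‖ ^ 2 ∂stdGaussian E = Module.finrank ℝ E := by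
  have hi : ∀ i, Integrable (fun z : E => inner ℝ (stdOrthonormalBasis ℝ E i) z ^ 2)
      (stdGaussian E) := fun i => by
    have := (IsGaussian.memLp_dual (stdGaussian E) (innerSL ℝ (stdOrthonormalBasis ℝ E i)) 2
      (by norm_num)).integrable_sq
    simpa using this
  have h : ∀ i, ∫ z : E, inner ℝ (stdOrthonormalBasis ℝ E i) z ^ 2 ∂stdGaussian E = 1 := by
    intro i
    have := variance_dual_stdGaussian (innerSL ℝ (stdOrthonormalBasis ℝ E i))
    rw [variance_of_integral_eq_zero (by fun_prop) (integral_strongDual_stdGaussian _)] at this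
    simpa [innerSL_apply_norm] using this
  simp_rw [← (stdOrthonormalBasis ℝ E).sum_sq_inner_right]
  rw [integral_finsetSum _ fun i _ => hi i]
  simp [h]

end GaussianMoments

/-! ### Setwise limits of probability measures -/

section SetwiseLimits

variable {E : Type*} [MeasurableSpace E]

/-- A set function that is a uniform limit, over measurable sets, of probability measures is itself
given by a probability measure. -/
theorem exists_isProbabilityMeasure_of_uniform_limit {μ : ℕ → Measure E}
    [∀ n, IsProbabilityMeasure (μ n)] {ℓ : Set E → ℝ} {b : ℕ → ℝ} (hb : Tendsto b atTop (nhds 0))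
    (h : ∀ n A, MeasurableSet A → |(μ n).real A - ℓ A| ≤ b n) :
    ∃ π : Measure E, IsProbabilityMeasure π ∧ ∀ A, MeasurableSet A → π.real A = ℓ A := by
  have hlim : ∀ A, MeasurableSet A → Tendsto (fun n => (μ n).real A) atTop (nhds (ℓ A)) := by
    intro A hA
    rw [tendsto_iff_norm_sub_tendsto_zero]
    exact squeeze_zero (fun n => norm_nonneg _) (fun n => h n A hA) hb
  have hnn : ∀ A, MeasurableSet A → 0 ≤ ℓ A := fun A hA =>
    ge_of_tendsto' (hlim A hA) fun n => measureReal_nonneg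
  have hempty : ℓ ∅ = 0 :=
    tendsto_nhds_unique (hlim ∅ .empty) (by simp)
  have huniv : ℓ Set.univ = 1 :=
    tendsto_nhds_unique (hlim Set.univ .univ) (by simp)
  have hsum : ∀ f : ℕ → Set E, (∀ i, MeasurableSet (f i)) → Pairwise (Function.onFun Disjoint f) →
      HasSum (fun i => ℓ (f i)) (ℓ (⋃ i, f i)) := by
    intro f hf hd
    have hfin : ∀ s : Finset ℕ, ∑ i ∈ s, ℓ (f i) = ℓ (⋃ i ∈ s, f i) := by
      intro s
      refine tendsto_nhds_unique (tendsto_finsetSum s fun i _ => hlim (f i) (hf i)) ?_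
      refine (hlim _ (s.measurableSet_biUnion fun i _ => hf i)).congr fun n => ?_
      exact measureReal_biUnion_finset (fun i _ j _ hij => hd hij) fun i _ => hf i
    have hn : ∀ n, HasSum (fun i => (μ n).real (f i)) ((μ n).real (⋃ i, f i)) := by
      intro n
      have := measure_iUnion (μ := μ n) hd hf
      rw [measureReal_def, this, ENNReal.tsum_toReal_eq fun i => measure_ne_top _ _]
      exact (ENNReal.summable_toReal (this ▸ measure_ne_top _ _)).hasSum
    rw [HasSum, Metric.tendsto_nhds]
    intro ε hε
    obtain ⟨n, hbn⟩ := (hb.eventually (gt_mem_nhds (show 0 < ε / 3 by positivity))).exists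
    have h1 := (Metric.tendsto_nhds.1 (hn n)) (ε / 3) (by positivity)
    filter_upwards [h1] with s hs
    have h2 := h n _ (s.measurableSet_biUnion fun i _ => hf i)
    have h3 := h n _ (MeasurableSet.iUnion hf)
    rw [measureReal_biUnion_finset (fun i _ j _ hij => hd hij) (fun i _ => hf i), ← hfin s] at h2
    rw [Real.dist_eq] at hs ⊢
    rw [abs_lt] at hs ⊢
    rw [abs_le] at h2 h3
    constructor <;> linarith [h2.1, h2.2, h3.1, h3.2, hs.1, hs.2]
  refine ⟨Measure.ofMeasurable (fun A _ => ENNReal.ofReal (ℓ A)) (by simp [hempty]) ?_, ⟨?_⟩, ?_⟩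
  · intro f hf hd
    have := hsum f hf hd
    rw [← this.tsum_eq, ENNReal.ofReal_tsum_of_nonneg (fun i => hnn _ (hf i)) this.summable]
  · rw [Measure.ofMeasurable_apply _ .univ, huniv, ENNReal.ofReal_one]
  · intro A hA
    rw [measureReal_def, Measure.ofMeasurable_apply _ hA, ENNReal.toReal_ofReal (hnn A hA)]

/-- Setwise convergence of probability measures implies convergence of the integrals of functions
with values in `[0, 1]`. -/
theorem tendsto_integral_of_tendsto_measureReal {μ : ℕ → Measure E} {π : Measure E}
    [∀ n, IsProbabilityMeasure (μ n)] [IsProbabilityMeasure π]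
    (h : ∀ A, MeasurableSet A → Tendsto (fun n => (μ n).real A) atTop (nhds (π.real A)))
    {f : E → ℝ} (hf : Measurable f) (h0 : ∀ x, 0 ≤ f x) (h1 : ∀ x, f x ≤ 1) :
    Tendsto (fun n => ∫ x, f x ∂μ n) atTop (nhds (∫ x, f x ∂π)) := by
  have hi : ∀ ν : Measure E, IsProbabilityMeasure ν →
      ∫ x, f x ∂ν = ∫ t in Set.Ioc 0 1, ν.real {a | t ≤ f a} := fun ν _ =>
    Integrable.integral_eq_integral_Ioc_meas_le
      (Integrable.of_bound hf.aestronglyMeasurable 1 (ae_of_all _ fun x => by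
        rw [Real.norm_of_nonneg (h0 x)]; exact h1 x)) (ae_of_all _ h0) (ae_of_all _ h1)
  simp_rw [hi π inferInstance, fun n => hi (μ n) inferInstance]
  refine tendsto_integral_of_dominated_convergence (fun _ => 1) (fun n => ?_) ?_ (fun n => ?_) ?_
  · refine (Antitone.measurable fun s t hst => ?_).aestronglyMeasurable
    exact measureReal_mono fun a (ha : t ≤ f a) => hst.trans ha
  · exact integrable_const _
  · refine ae_of_all _ fun t => ?_
    rw [Real.norm_of_nonneg measureReal_nonneg]
    exact measureReal_le_one
  · exact ae_of_all _ fun t => h _ (measurableSet_le measurable_const hf)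

end SetwiseLimits

/-! ### Iterated Markov kernels -/

section MarkovKernels

variable {E : Type*} [MeasurableSpace E]

theorem measureReal_bind (μ : Measure E) [IsFiniteMeasure μ] (κ : Kernel E E) [IsMarkovKernel κ]
    {A : Set E} (hA : MeasurableSet A) : (μ.bind κ).real A = ∫ x, (κ x).real A ∂μ := by
  rw [measureReal_def, Measure.bind_apply hA κ.aemeasurable]
  exact (integral_toReal (κ.measurable_coe hA).aemeasurable
    (ae_of_all _ fun x => measure_lt_top _ _)).symm

instance isMarkovKernel_pow (κ : Kernel E E) [IsMarkovKernel κ] (n : ℕ) :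
    IsMarkovKernel (κ ^ n) := by
  induction n with
  | zero => rw [pow_zero]; exact inferInstanceAs (IsMarkovKernel Kernel.id)
  | succ n ih => rw [pow_succ]; exact inferInstanceAs (IsMarkovKernel ((κ ^ n) ∘ₖ κ))

theorem pow_succ_apply_eq_bind (κ : Kernel E E) (n : ℕ) (x : E) :
    (κ ^ (n + 1)) x = ((κ ^ n) x).bind κ := by
  rw [pow_succ']; exact Kernel.comp_apply _ _ _

theorem pow_succ_apply_eq_bind' (κ : Kernel E E) (n : ℕ) (x : E) :
    (κ ^ (n + 1)) x = (κ x).bind (κ ^ n : Kernel E E) := by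
  rw [pow_succ]; exact Kernel.comp_apply _ _ _

theorem invariant_pow {κ : Kernel E E} {ν : Measure E} (h : κ.Invariant ν) (n : ℕ) :
    (κ ^ n).Invariant ν := by
  induction n with
  | zero => rw [pow_zero]; exact Measure.id_comp
  | succ n ih => rw [pow_succ]; exact ih.comp h

theorem measurable_measureReal_kernel (κ : Kernel E E) {A : Set E} (hA : MeasurableSet A) :
    Measurable fun x => (κ x).real A :=
  (κ.measurable_coe hA).ennreal_toReal

theorem integrable_measureReal_pow (κ : Kernel E E) [IsMarkovKernel κ] (n : ℕ) {A : Set E}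
    (hA : MeasurableSet A) (ν : Measure E) [IsFiniteMeasure ν] : Integrable (fun y => ((κ ^ n) y).real A) ν :=
  Integrable.of_bound (measurable_measureReal_kernel _ hA).aestronglyMeasurable 1
    (ae_of_all _ fun x => by rw [Real.norm_of_nonneg measureReal_nonneg]; exact measureReal_le_one)

end MarkovKernels

/-! ### Kernels that contract Lipschitz functions and smooth indicator functions -/

/-- A kernel on a normed space that contracts the Lipschitz constants of `[0, 1]`-valued functions by
the factor `ρ < 1`, maps indicator functions to `C`-Lipschitz functions, and has a finite first
moment at the origin. The two regularity properties are dual to a Wasserstein contraction and to a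
bound of the total variation distance by the distance of the starting points; in this form no
couplings are needed. -/
structure IsContractiveSmoothing {E : Type*} [NormedAddCommGroup E] [MeasurableSpace E]
    (κ : Kernel E E) (ρ C : ℝ) : Prop where
  nonneg : 0 ≤ ρ
  lt_one : ρ < 1
  const_nonneg : 0 ≤ C
  contracts : ∀ (f : E → ℝ) (c : ℝ), Measurable f → (∀ x, 0 ≤ f x) → (∀ x, f x ≤ 1) → 0 ≤ c →
    (∀ x y, |f x - f y| ≤ c * ‖x - y‖) →
    ∀ x y, |∫ z, f z ∂κ x - ∫ z, f z ∂κ y| ≤ c * ρ * ‖x - y‖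
  smooths : ∀ A, MeasurableSet A → ∀ x y, |(κ x).real A - (κ y).real A| ≤ C * ‖x - y‖
  integrable_norm : Integrable (fun y => ‖y‖) (κ 0)

namespace IsContractiveSmoothing

variable {E : Type*} [NormedAddCommGroup E] [MeasurableSpace E] {κ : Kernel E E}
  [IsMarkovKernel κ] {ρ C : ℝ}

/-- The last step smooths the indicator function of `A` and the `n` steps before it contract the
result. -/
theorem abs_pow_sub_le (h : IsContractiveSmoothing κ ρ C) (n : ℕ) {A : Set E}
    (hA : MeasurableSet A) (x y : E) :
    |((κ ^ (n + 1)) x).real A - ((κ ^ (n + 1)) y).real A| ≤ C * ρ ^ n * ‖x - y‖ := by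
  induction n generalizing x y with
  | zero => simpa using h.smooths A hA x y
  | succ n ih =>
    rw [pow_succ_apply_eq_bind', pow_succ_apply_eq_bind', measureReal_bind _ _ hA,
      measureReal_bind _ _ hA, pow_succ ρ, ← mul_assoc]
    exact h.contracts _ _ (measurable_measureReal_kernel _ hA) (fun x => measureReal_nonneg)
      (fun x => measureReal_le_one) (mul_nonneg h.const_nonneg (pow_nonneg h.nonneg n)) ih x y

/-- Convergence to any invariant probability measure. No moment of `ν` is required, since the
differences of transition probabilities are bounded by `1`. -/
theorem tendsto_of_invariant (h : IsContractiveSmoothing κ ρ C) {ν : Measure E}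
    [IsProbabilityMeasure ν] (hν : κ.Invariant ν) {A : Set E} (hA : MeasurableSet A) (x : E) :
    Tendsto (fun n => ((κ ^ (n + 1)) x).real A) atTop (nhds (ν.real A)) := by
  have hd : Tendsto (fun n => ∫ y, (((κ ^ (n + 1)) x).real A - ((κ ^ (n + 1)) y).real A) ∂ν)
      atTop (nhds (∫ _, (0 : ℝ) ∂ν)) := by
    refine tendsto_integral_of_dominated_convergence (fun _ => 1) (fun n => ?_)
      (integrable_const _) (fun n => ae_of_all _ fun y => ?_) (ae_of_all _ fun y => ?_)
    · exact (measurable_const.sub (measurable_measureReal_kernel _ hA)).aestronglyMeasurable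
    · rw [Real.norm_eq_abs, abs_le]
      have a1 : ((κ ^ (n + 1)) x).real A ≤ 1 := measureReal_le_one
      have a2 : ((κ ^ (n + 1)) y).real A ≤ 1 := measureReal_le_one
      have a3 : 0 ≤ ((κ ^ (n + 1)) x).real A := measureReal_nonneg
      have a4 : 0 ≤ ((κ ^ (n + 1)) y).real A := measureReal_nonneg
      constructor <;> linarith
    · refine squeeze_zero_norm (fun n => h.abs_pow_sub_le n hA x y) ?_
      have := ((tendsto_pow_atTop_nhds_zero_of_lt_one h.nonneg h.lt_one).const_mul C).mul_const
        ‖x - y‖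
      simpa using this
  rw [integral_zero] at hd
  have e : ∀ n, ∫ y, (((κ ^ (n + 1)) x).real A - ((κ ^ (n + 1)) y).real A) ∂ν
      = ((κ ^ (n + 1)) x).real A - ν.real A := by
    intro n
    rw [integral_sub (integrable_const _) (integrable_measureReal_pow κ (n + 1) hA ν),
      ← measureReal_bind _ _ hA, (invariant_pow hν (n + 1)).def]
    simp
  simp_rw [e] at hd
  simpa using hd.add_const (ν.real A)

theorem eq_of_invariant (h : IsContractiveSmoothing κ ρ C) {ν π : Measure E}
    [IsProbabilityMeasure ν] [IsProbabilityMeasure π] (hν : κ.Invariant ν) (hπ : κ.Invariant π) :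
    ν = π := by
  ext A hA
  have := tendsto_nhds_unique (h.tendsto_of_invariant hν hA 0) (h.tendsto_of_invariant hπ hA 0)
  rwa [measureReal_def, measureReal_def,
    ENNReal.toReal_eq_toReal_iff' (measure_ne_top _ _) (measure_ne_top _ _)] at this

variable [BorelSpace E]

/-- A geometric drift condition bounds the second moment of the invariant measure by lower
semicontinuity along the chain started at the origin. -/
theorem lintegral_norm_sq_le_of_drift (h : IsContractiveSmoothing κ ρ C) {π : Measure E}
    [IsProbabilityMeasure π] (hπ : κ.Invariant π) {a B : ℝ} (ha0 : 0 ≤ a) (ha1 : a ≤ 1)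
    (hB : 0 ≤ B)
    (hdrift : ∀ x, ∫⁻ y, ENNReal.ofReal (‖y‖ ^ 2) ∂κ x
      ≤ ENNReal.ofReal (a * ‖x‖ ^ 2 + (1 - a) * B)) :
    ∫⁻ y, ENNReal.ofReal (‖y‖ ^ 2) ∂π ≤ ENNReal.ofReal B := by
  have hn : ∀ n : ℕ, ∫⁻ y, ENNReal.ofReal (‖y‖ ^ 2) ∂((κ ^ n) 0) ≤ ENNReal.ofReal B := by
    intro n
    induction n with
    | zero =>
      have : (κ ^ 0) (0 : E) = Measure.dirac 0 := by rw [pow_zero]; exact Kernel.id_apply _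
      rw [this, lintegral_dirac' _ (by fun_prop)]
      simp
    | succ n ih =>
      rw [pow_succ_apply_eq_bind, Measure.lintegral_bind κ.aemeasurable (by fun_prop)]
      calc ∫⁻ x, ∫⁻ y, ENNReal.ofReal (‖y‖ ^ 2) ∂κ x ∂((κ ^ n) 0)
          ≤ ∫⁻ x, (ENNReal.ofReal a * ENNReal.ofReal (‖x‖ ^ 2) + ENNReal.ofReal ((1 - a) * B))
              ∂((κ ^ n) 0) := by
            refine lintegral_mono fun x => (hdrift x).trans ?_
            rw [ENNReal.ofReal_add (by positivity) (mul_nonneg (by linarith) hB),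
              ENNReal.ofReal_mul ha0]
        _ = ENNReal.ofReal a * ∫⁻ x, ENNReal.ofReal (‖x‖ ^ 2) ∂((κ ^ n) 0)
              + ENNReal.ofReal ((1 - a) * B) := by
            rw [lintegral_add_right _ measurable_const, lintegral_const_mul _ (by fun_prop)]
            simp
        _ ≤ ENNReal.ofReal a * ENNReal.ofReal B + ENNReal.ofReal ((1 - a) * B) := by gcongr
        _ = ENNReal.ofReal B := by
            rw [← ENNReal.ofReal_mul ha0, ← ENNReal.ofReal_add (by positivity)
              (mul_nonneg (by linarith) hB)]
            congr 1; ring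
  refine (lintegral_le_liminf_lintegral_of_forall_isOpen_measure_le_liminf_measure
    (μs := fun n => (κ ^ (n + 1)) 0) (by fun_prop) (fun x => by positivity) fun G hG => ?_).trans ?_
  · have := h.tendsto_of_invariant hπ hG.measurableSet 0
    have h2 := (ENNReal.tendsto_toReal_iff (fun n => measure_ne_top ((κ ^ (n + 1)) 0) G)
      (measure_ne_top π G)).1 this
    exact h2.liminf_eq.ge
  · exact (liminf_le_liminf (Eventually.of_forall fun n => hn (n + 1))).trans (by simp)

variable [SecondCountableTopology E]

theorem abs_pow_sub_bind_le (h : IsContractiveSmoothing κ ρ C) (n : ℕ) {A : Set E}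
    (hA : MeasurableSet A) (x : E) (ν : Measure E) [IsProbabilityMeasure ν]
    (hν : Integrable (fun y => ‖y‖) ν) :
    |((κ ^ (n + 1)) x).real A - (ν.bind (κ ^ (n + 1) : Kernel E E)).real A|
      ≤ C * ρ ^ n * ∫ y, ‖x - y‖ ∂ν := by
  have hi := integrable_measureReal_pow κ (n + 1) hA ν
  have hxy : Integrable (fun y => ‖x - y‖) ν :=
    Integrable.mono' ((integrable_const ‖x‖).add hν)
      (measurable_const.sub measurable_id).norm.aestronglyMeasurable
      (ae_of_all _ fun y => by rw [norm_norm]; exact norm_sub_le _ _)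
  have e : ((κ ^ (n + 1)) x).real A = ∫ _, ((κ ^ (n + 1)) x).real A ∂ν := by simp
  rw [measureReal_bind _ _ hA, e, ← integral_sub (integrable_const _) hi, ← integral_const_mul,
    ← Real.norm_eq_abs]
  exact norm_integral_le_of_norm_le (hxy.const_mul _)
    (ae_of_all _ fun y => h.abs_pow_sub_le n hA x y)

/-- The laws started at the origin form a Cauchy sequence uniformly over measurable sets; their
limit is invariant. -/
theorem exists_invariant (h : IsContractiveSmoothing κ ρ C) :
    ∃ π : Measure E, IsProbabilityMeasure π ∧ κ.Invariant π := by
  set M := ∫ y, ‖(0 : E) - y‖ ∂κ 0 with hM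
  have hstep : ∀ n A, MeasurableSet A →
      dist (((κ ^ (n + 1)) 0).real A) (((κ ^ (n + 1 + 1)) 0).real A) ≤ C * M * ρ ^ n := by
    intro n A hA
    rw [pow_succ_apply_eq_bind' κ (n + 1), Real.dist_eq]
    exact (h.abs_pow_sub_bind_le n hA 0 (κ 0) h.integrable_norm).trans (by rw [hM]; linarith)
  have hlim : ∀ A, ∃ l, MeasurableSet A → Tendsto (fun n => ((κ ^ (n + 1)) 0).real A) atTop
      (nhds l) := by
    intro A
    by_cases hA : MeasurableSet A
    · obtain ⟨l, hl⟩ := cauchySeq_tendsto_of_complete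
        (cauchySeq_of_le_geometric ρ (C * M) h.lt_one fun n => hstep n A hA)
      exact ⟨l, fun _ => hl⟩
    · exact ⟨0, fun hA' => absurd hA' hA⟩
  choose ℓ hℓ using hlim
  have hunif : ∀ n A, MeasurableSet A →
      |((κ ^ (n + 1)) 0).real A - ℓ A| ≤ C * M * ρ ^ n / (1 - ρ) := fun n A hA =>
    dist_le_of_le_geometric_of_tendsto ρ (C * M) h.lt_one (fun n => hstep n A hA) (hℓ A hA) n
  have hb : Tendsto (fun n => C * M * ρ ^ n / (1 - ρ)) atTop (nhds 0) := by
    have := ((tendsto_pow_atTop_nhds_zero_of_lt_one h.nonneg h.lt_one).const_mul (C * M)).div_const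
      (1 - ρ)
    simpa using this
  obtain ⟨π, hπ, hπℓ⟩ := exists_isProbabilityMeasure_of_uniform_limit hb hunif
  have hconv : ∀ A, MeasurableSet A →
      Tendsto (fun n => ((κ ^ (n + 1)) 0).real A) atTop (nhds (π.real A)) := fun A hA => by
    rw [hπℓ A hA]; exact hℓ A hA
  refine ⟨π, hπ, ?_⟩
  refine Measure.ext fun A hA => ?_
  have : IsProbabilityMeasure (π.bind κ) := inferInstance
  rw [← ENNReal.toReal_eq_toReal_iff' (measure_ne_top _ _) (measure_ne_top _ _),
    ← measureReal_def, ← measureReal_def, measureReal_bind _ _ hA]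
  refine tendsto_nhds_unique (tendsto_integral_of_tendsto_measureReal hconv
    (measurable_measureReal_kernel κ hA) (fun x => measureReal_nonneg)
    fun x => measureReal_le_one) ?_
  refine ((tendsto_add_atTop_iff_nat 1).2 (hconv A hA)).congr fun n => ?_
  rw [pow_succ_apply_eq_bind κ (n + 1), measureReal_bind _ _ hA]

end IsContractiveSmoothing

/-! ### Second moments of sums weighted by the midpoint selectors -/

section Selectors

/-- The joint law of the `K` independent Bernoulli midpoint selectors. -/
noncomputable def selectorLaw (K : ℕ) : Measure (Fin K → ℝ) :=
  Measure.pi fun _ => bernoulliMeasure (1 : ℝ) 0 (invNat K)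

instance (K : ℕ) : IsProbabilityMeasure (selectorLaw K) := by
  unfold selectorLaw; infer_instance

variable {K : ℕ}

theorem integrable_selector (i : Fin K) : Integrable (fun H : Fin K → ℝ => H i) (selectorLaw K) :=
  integrable_comp_eval (f := fun x => x) (integrable_bernoulliMeasure _ _ _ _)

theorem integral_selector (i : Fin K) : ∫ H, H i ∂selectorLaw K = 1 / K := by
  unfold selectorLaw
  have h := integral_comp_eval (μ := fun _ : Fin K => bernoulliMeasure (1 : ℝ) 0 (invNat K))
    (i := i) (f := fun x => x) (integrable_bernoulliMeasure _ _ _ _).1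
  rw [h, integral_bernoulliMeasure]
  simp [invNat]

theorem indepFun_selector {i j : Fin K} (hij : i ≠ j) :
    IndepFun (fun H : Fin K → ℝ => H i) (fun H => H j) (selectorLaw K) :=
  (iIndepFun_pi (X := fun _ => id) fun _ => aemeasurable_id).indepFun hij

theorem integrable_selector_mul (i j : Fin K) :
    Integrable (fun H : Fin K → ℝ => H i * H j) (selectorLaw K) := by
  rcases eq_or_ne i j with rfl | hij
  · exact integrable_comp_eval (f := fun x => x * x) (integrable_bernoulliMeasure _ _ _ _)
  · exact (indepFun_selector hij).integrable_mul (integrable_selector i) (integrable_selector j)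

theorem integral_selector_mul (i j : Fin K) :
    ∫ H, H i * H j ∂selectorLaw K = if i = j then 1 / (K : ℝ) else 1 / (K : ℝ) * (1 / K) := by
  split_ifs with hij
  · subst hij
    unfold selectorLaw
    have h := integral_comp_eval (μ := fun _ : Fin K => bernoulliMeasure (1 : ℝ) 0 (invNat K))
      (i := i) (f := fun x => x * x) (integrable_bernoulliMeasure _ _ _ _).1
    rw [h, integral_bernoulliMeasure]
    simp [invNat]
  · rw [(indepFun_selector hij).integral_fun_mul_eq_mul_integral
      (integrable_selector i).1 (integrable_selector j).1, integral_selector, integral_selector]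

variable {F : Type*} [NormedAddCommGroup F] [InnerProductSpace ℝ F]

theorem norm_add_smul_sum_sq (v : F) (R : Fin K → F) (η : ℝ) (H : Fin K → ℝ) :
    ‖v + η • ∑ i, H i • R i‖ ^ 2 = ‖v‖ ^ 2 + 2 * η * ∑ i, H i * inner ℝ v (R i)
      + η ^ 2 * ∑ i, ∑ j, H i * H j * inner ℝ (R i) (R j) := by
  rw [norm_add_sq_real, inner_smul_right, norm_smul, mul_pow, Real.norm_eq_abs, sq_abs,
    ← real_inner_self_eq_norm_sq (∑ i, H i • R i), inner_sum, sum_inner]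
  simp_rw [inner_sum, inner_smul_left, inner_smul_right]
  congr 2
  · ring
  · refine Finset.sum_congr rfl fun i _ => Finset.sum_congr rfl fun j _ => ?_
    simp; ring

theorem integrable_norm_add_smul_sum_sq (v : F) (R : Fin K → F) (η : ℝ) :
    Integrable (fun H : Fin K → ℝ => ‖v + η • ∑ i, H i • R i‖ ^ 2) (selectorLaw K) := by
  simp_rw [norm_add_smul_sum_sq]
  refine ((integrable_const _).add ((integrable_finsetSum _ fun i _ =>
    (integrable_selector i).mul_const _).const_mul _)).add
    ((integrable_finsetSum _ fun i _ => integrable_finsetSum _ fun j _ =>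
      (integrable_selector_mul i j).mul_const _).const_mul _)

/-- Averaging over the selectors: the diagonal part of the second moment is the mean of the
`‖R i‖ ^ 2`, and the off-diagonal part is at most that mean again. One of the two is absorbed into
the squares `‖v + η • R i‖ ^ 2`. -/
theorem integral_norm_add_smul_sum_sq_le (hK : 1 ≤ K) (v : F) (R : Fin K → F) (η : ℝ) :
    ∫ H, ‖v + η • ∑ i, H i • R i‖ ^ 2 ∂selectorLaw K
      ≤ 1 / K * ∑ i, (‖v + η • R i‖ ^ 2 + η ^ 2 * ‖R i‖ ^ 2) := by
  have hK0 : (K : ℝ) ≠ 0 := by positivity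
  simp_rw [norm_add_smul_sum_sq]
  have i1 : Integrable (fun H : Fin K → ℝ => ∑ i, H i * inner ℝ v (R i)) (selectorLaw K) :=
    integrable_finsetSum _ fun i _ => (integrable_selector i).mul_const _
  have i2 : ∀ i, Integrable (fun H : Fin K → ℝ => ∑ j, H i * H j * inner ℝ (R i) (R j))
      (selectorLaw K) := fun i => integrable_finsetSum _ fun j _ =>
    (integrable_selector_mul i j).mul_const _
  rw [integral_add (f := fun H : Fin K → ℝ => ‖v‖ ^ 2 + 2 * η * ∑ i, H i * inner ℝ v (R i))
      ((integrable_const _).add (i1.const_mul _))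
      ((integrable_finsetSum _ fun i _ => i2 i).const_mul _),
    integral_add (integrable_const _) (i1.const_mul _), integral_const_mul, integral_const_mul,
    integral_finsetSum _ fun i _ => (integrable_selector i).mul_const _,
    integral_finsetSum _ fun i _ => i2 i]
  simp_rw [integral_finsetSum _ fun j _ => (integrable_selector_mul _ j).mul_const _,
    integral_mul_const, integral_selector, integral_selector_mul]
  have hij : ∀ i j : Fin K, (if i = j then 1 / (K : ℝ) else 1 / (K : ℝ) * (1 / K))
      * inner ℝ (R i) (R j) ≤ (if i = j then 1 / (K : ℝ) * ‖R i‖ ^ 2 else 0)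
        + 1 / (K : ℝ) * (1 / K) * ((‖R i‖ ^ 2 + ‖R j‖ ^ 2) / 2) := by
    intro i j
    split_ifs with h
    · subst h
      rw [real_inner_self_eq_norm_sq]
      have : 0 ≤ 1 / (K : ℝ) * (1 / K) * ((‖R i‖ ^ 2 + ‖R i‖ ^ 2) / 2) := by positivity
      linarith
    · rw [zero_add]
      refine mul_le_mul_of_nonneg_left ?_ (by positivity)
      have := norm_sub_sq_real (R i) (R j)
      nlinarith [sq_nonneg ‖R i - R j‖]
  have hsum := Finset.sum_le_sum fun i (_ : i ∈ Finset.univ) =>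
    Finset.sum_le_sum fun j (_ : j ∈ Finset.univ) => hij i j
  have hval : ∑ i : Fin K, ∑ j : Fin K, ((if i = j then 1 / (K : ℝ) * ‖R i‖ ^ 2 else 0)
        + 1 / (K : ℝ) * (1 / K) * ((‖R i‖ ^ 2 + ‖R j‖ ^ 2) / 2))
      = 2 * (1 / K * ∑ i, ‖R i‖ ^ 2) := by
    simp only [Finset.sum_add_distrib, Finset.sum_ite_eq, Finset.mem_univ, if_true,
      ← Finset.mul_sum, ← Finset.sum_div, Finset.sum_const, Finset.card_univ, Fintype.card_fin,
      nsmul_eq_mul]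
    field_simp
    ring
  rw [hval] at hsum
  have hη := mul_le_mul_of_nonneg_left hsum (sq_nonneg η)
  have e : 1 / (K : ℝ) * ∑ i, (‖v + η • R i‖ ^ 2 + η ^ 2 * ‖R i‖ ^ 2)
      = ‖v‖ ^ 2 + 2 * η * ∑ i, 1 / (K : ℝ) * inner ℝ v (R i)
        + η ^ 2 * (2 * (1 / K * ∑ i, ‖R i‖ ^ 2)) := by
    simp only [norm_add_sq_real, inner_smul_right, norm_smul, mul_pow, Real.norm_eq_abs, sq_abs,
      Finset.sum_add_distrib, ← Finset.mul_sum, Finset.sum_const, Finset.card_univ,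
      Fintype.card_fin, nsmul_eq_mul]
    field_simp
    ring
  rw [e]
  simp only [integral_const, probReal_univ, one_smul]
  linarith

end Selectors

/-! ### Contraction at a single midpoint -/

section Pointwise

variable {F : Type*} [NormedAddCommGroup F] [InnerProductSpace ℝ F]

/-- Contraction for a single midpoint. Here `D = x - y`, `G` is the difference of the gradients at `x`
and `y`, and `Ghat` that at the two midpoints, whose difference is `D - t • G`. The left-hand side
equals `‖D‖ ^ 2 - 2 η ⟪D, Ghat⟫` up to order `η ^ 2`, and `⟪D, Ghat⟫` differs by `O(t)` from
`⟪D - t • G, Ghat⟫`, to which monotonicity applies. -/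
theorem midpoint_contraction {m ℓ η t : ℝ} (hm : 0 < m) (hℓ : 0 ≤ ℓ) (hη : 0 ≤ η) (ht0 : 0 ≤ t)
    (ht : t ≤ η) (hηℓ : η * ℓ ≤ 1) (hηm : η * (4 * m * ℓ + 17 * ℓ ^ 2) ≤ m) {D G Ghat : F}
    (hDG : ‖G‖ ≤ ℓ * ‖D‖) (hG : ‖Ghat‖ ≤ ℓ * ‖D - t • G‖)
    (hmono : m * ‖D - t • G‖ ^ 2 ≤ inner ℝ (D - t • G) Ghat) :
    ‖D - η • Ghat‖ ^ 2 + η ^ 2 * ‖G - Ghat‖ ^ 2 ≤ (1 - η * m) * ‖D‖ ^ 2 := by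
  have hD := norm_nonneg D
  have htℓ : t * ℓ ≤ 1 := (mul_le_mul_of_nonneg_right ht hℓ).trans hηℓ
  have hDhat : ‖D - t • G‖ ≤ 2 * ‖D‖ := by
    calc ‖D - t • G‖ ≤ ‖D‖ + ‖t • G‖ := norm_sub_le _ _
      _ = ‖D‖ + t * ‖G‖ := by rw [norm_smul, Real.norm_of_nonneg ht0]
      _ ≤ ‖D‖ + t * (ℓ * ‖D‖) := by gcongr
      _ = ‖D‖ + (t * ℓ) * ‖D‖ := by ring
      _ ≤ ‖D‖ + 1 * ‖D‖ := by gcongr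
      _ = 2 * ‖D‖ := by ring
  have hGhat : ‖Ghat‖ ≤ 2 * ℓ * ‖D‖ := hG.trans (by nlinarith)
  have hR : ‖G - Ghat‖ ≤ 3 * ℓ * ‖D‖ := (norm_sub_le _ _).trans (by linarith)
  have e1 : ‖D - η • Ghat‖ ^ 2 + η ^ 2 * ‖G - Ghat‖ ^ 2
      = ‖D‖ ^ 2 - 2 * η * inner ℝ D Ghat + η ^ 2 * (‖Ghat‖ ^ 2 + ‖G - Ghat‖ ^ 2) := by
    rw [norm_sub_sq_real D, inner_smul_right, norm_smul, mul_pow, Real.norm_eq_abs, sq_abs]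
    ring
  have hDhat2 : (1 - 2 * t * ℓ) * ‖D‖ ^ 2 ≤ ‖D - t • G‖ ^ 2 := by
    have h1 : inner ℝ D G ≤ ℓ * ‖D‖ ^ 2 :=
      (real_inner_le_norm _ _).trans (by nlinarith)
    rw [norm_sub_sq_real, inner_smul_right]
    nlinarith [mul_le_mul_of_nonneg_left h1 ht0, sq_nonneg ‖t • G‖]
  have hGG : - (2 * ℓ ^ 2 * ‖D‖ ^ 2) ≤ inner ℝ G Ghat := by
    have h1 := neg_le_of_abs_le (abs_real_inner_le_norm G Ghat)
    have h2 : ‖G‖ * ‖Ghat‖ ≤ (ℓ * ‖D‖) * (2 * ℓ * ‖D‖) := by gcongr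
    nlinarith
  have hin : (m - 2 * η * m * ℓ - 2 * η * ℓ ^ 2) * ‖D‖ ^ 2 ≤ inner ℝ D Ghat := by
    have e2 : inner ℝ D Ghat = inner ℝ (D - t • G) Ghat + t * inner ℝ G Ghat := by
      rw [inner_sub_left, inner_smul_left]; simp
    have h1 := mul_le_mul_of_nonneg_left hDhat2 hm.le
    have h2 := mul_le_mul_of_nonneg_left hGG ht0
    have h3 : (2 * m * ℓ * ‖D‖ ^ 2) * t ≤ (2 * m * ℓ * ‖D‖ ^ 2) * η := by gcongr
    have h4 : (2 * ℓ ^ 2 * ‖D‖ ^ 2) * t ≤ (2 * ℓ ^ 2 * ‖D‖ ^ 2) * η := by gcongr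
    rw [e2]
    linarith
  have hq : ‖Ghat‖ ^ 2 + ‖G - Ghat‖ ^ 2 ≤ 13 * ℓ ^ 2 * ‖D‖ ^ 2 := by
    have h1 : ‖Ghat‖ ^ 2 ≤ (2 * ℓ * ‖D‖) ^ 2 := by gcongr
    have h2 : ‖G - Ghat‖ ^ 2 ≤ (3 * ℓ * ‖D‖) ^ 2 := by gcongr
    linarith
  rw [e1]
  have h1 := mul_le_mul_of_nonneg_left hin (show 0 ≤ 2 * η by positivity)
  have h2 := mul_le_mul_of_nonneg_left hq (sq_nonneg η)
  have h3 := mul_le_mul_of_nonneg_right hηm (show 0 ≤ η * ‖D‖ ^ 2 by positivity)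
  linarith

end Pointwise

/-! ### From second moments to first moments -/

section SecondMoment

theorem integrable_and_integral_le_of_lintegral_sq_le {Ω : Type*} [MeasurableSpace Ω]
    {P : Measure Ω} [IsProbabilityMeasure P] {f : Ω → ℝ} (hf : Measurable f) {b : ℝ} (hb : 0 ≤ b)
    (h : ∫⁻ ω, ENNReal.ofReal (f ω ^ 2) ∂P ≤ ENNReal.ofReal (b ^ 2)) :
    Integrable f P ∧ Integrable (fun ω => f ω ^ 2) P ∧ ∫ ω, f ω ^ 2 ∂P ≤ b ^ 2
      ∧ ∫ ω, f ω ∂P ≤ b := by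
  have hsq : Integrable (fun ω => f ω ^ 2) P :=
    ⟨(hf.pow_const 2).aestronglyMeasurable, by
      rw [hasFiniteIntegral_iff_ofReal (ae_of_all _ fun ω => sq_nonneg _)]
      exact h.trans_lt ENNReal.ofReal_lt_top⟩
  have hmem : MemLp f 2 P := (memLp_two_iff_integrable_sq hf.aestronglyMeasurable).2 hsq
  have hle : ∫ ω, f ω ^ 2 ∂P ≤ b ^ 2 := by
    rw [integral_eq_lintegral_of_nonneg_ae (ae_of_all _ fun ω => sq_nonneg _)
      (hf.pow_const 2).aestronglyMeasurable]
    exact ENNReal.toReal_le_of_le_ofReal (sq_nonneg b) h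
  refine ⟨hmem.integrable (by norm_num), hsq, hle, ?_⟩
  have hvar := variance_nonneg f P
  rw [variance_eq_sub hmem] at hvar
  simp only [Pi.pow_apply] at hvar
  exact (abs_le_of_sq_le_sq' (by linarith) hb).2

end SecondMoment

/-! ### Mean square estimates for one step -/

section OneStep

theorem integrable_norm_add_smul_sq_stdGaussian {E : Type*} [NormedAddCommGroup E]
    [InnerProductSpace ℝ E] [FiniteDimensional ℝ E] [MeasurableSpace E] [BorelSpace E] (a : E)
    (s : ℝ) : Integrable (fun z : E => ‖a + s • z‖ ^ 2) (stdGaussian E) :=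
  (((memLp_const a).add ((IsGaussian.memLp_two_id (μ := stdGaussian E)).const_smul s))
    ).integrable_norm_pow (by norm_num)

theorem integral_norm_add_smul_sq_stdGaussian {E : Type*} [NormedAddCommGroup E]
    [InnerProductSpace ℝ E] [FiniteDimensional ℝ E] [MeasurableSpace E] [BorelSpace E] (a : E)
    (s : ℝ) : ∫ z : E, ‖a + s • z‖ ^ 2 ∂stdGaussian E
      = ‖a‖ ^ 2 + s ^ 2 * Module.finrank ℝ E := by
  have h : ∀ z : E, ‖a + s • z‖ ^ 2 = ‖a‖ ^ 2 + 2 * s * inner ℝ a z + s ^ 2 * ‖z‖ ^ 2 := by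
    intro z
    rw [norm_add_sq_real, inner_smul_right, norm_smul, mul_pow, Real.norm_eq_abs, sq_abs]
    ring
  have hi : Integrable (fun z : E => inner ℝ a z) (stdGaussian E) :=
    (IsGaussian.integrable_id (μ := stdGaussian E)).const_inner a
  simp_rw [h]
  rw [integral_add (f := fun z : E => ‖a‖ ^ 2 + 2 * s * inner ℝ a z)
      ((integrable_const _).add (hi.const_mul _)) (integrable_norm_sq_stdGaussian.const_mul _),
    integral_add (integrable_const _) (hi.const_mul _), integral_const_mul, integral_const_mul,
    integral_inner_stdGaussian, integral_norm_sq_stdGaussian]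
  simp

variable {d K : ℕ} {m L η : ℝ} {U : EuclideanSpace ℝ (Fin d) → ℝ}

theorem lintegral_noiseLaw {f : Noise d K → ENNReal} (hf : Measurable f) :
    ∫⁻ w, f w ∂noiseLaw d K = ∫⁻ p, ∫⁻ H, f (H, p) ∂selectorLaw K
      ∂((Measure.pi fun _ : Fin K => stdGaussian (EuclideanSpace ℝ (Fin d))).prod
        (stdGaussian (EuclideanSpace ℝ (Fin d)))) :=
  lintegral_prod_symm' f hf

theorem lintegral_selectorLaw_le {F : Type*} [NormedAddCommGroup F] [InnerProductSpace ℝ F]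
    (hK : 1 ≤ K) (v : F) (R : Fin K → F) (η : ℝ) :
    ∫⁻ H, ENNReal.ofReal (‖v + η • ∑ i, H i • R i‖ ^ 2) ∂selectorLaw K
      ≤ ENNReal.ofReal (1 / K * ∑ i, (‖v + η • R i‖ ^ 2 + η ^ 2 * ‖R i‖ ^ 2)) := by
  rw [← ofReal_integral_eq_lintegral_ofReal (integrable_norm_add_smul_sum_sq v R η)
    (ae_of_all _ fun _ => by positivity)]
  exact ENNReal.ofReal_le_ofReal (integral_norm_add_smul_sum_sq_le hK v R η)

theorem average_le {f : Fin K → ℝ} {b : ℝ} (hK : 1 ≤ K) (h : ∀ i, f i ≤ b) :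
    1 / (K : ℝ) * ∑ i, f i ≤ b := by
  have hK0 : (0 : ℝ) < K := by positivity
  rw [one_div, inv_mul_le_iff₀ hK0]
  exact (Finset.sum_le_sum fun i _ => h i).trans (by simp)

theorem time_nonneg (hη : 0 ≤ η) (i : Fin K) : 0 ≤ (i : ℝ) * η / K := by positivity

theorem time_le (hη : 0 ≤ η) (i : Fin K) : (i : ℝ) * η / K ≤ η := by
  have hK0 : (0 : ℝ) < K := by exact_mod_cast i.pos
  have : (i : ℝ) ≤ K := by exact_mod_cast i.isLt.le
  rw [div_le_iff₀ hK0, mul_comm]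
  gcongr

/-- Two chains driven by the same randomness contract in mean square. -/
theorem lintegral_norm_step_sub_sq_le (hU : IsPotential m L U) (hK : 1 ≤ K) (hm : 0 < m)
    (hη : 0 < η) (hηL : η * |L| ≤ 1) (hηm : η * (4 * m * |L| + 17 * |L| ^ 2) ≤ m)
    (x y : EuclideanSpace ℝ (Fin d)) :
    ∫⁻ w, ENNReal.ofReal (‖step U η K x w - step U η K y w‖ ^ 2) ∂noiseLaw d K
      ≤ ENNReal.ofReal ((1 - η * m) * ‖x - y‖ ^ 2) := by
  have hmx := measurable_step_right U η K x
  have hmy := measurable_step_right U η K y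
  rw [lintegral_noiseLaw (by fun_prop)]
  refine (lintegral_mono (g := fun _ => ENNReal.ofReal ((1 - η * m) * ‖x - y‖ ^ 2))
    fun p => ?_).trans (by simp)
  set G := gradient U x - gradient U y with hG
  set Gh : Fin K → EuclideanSpace ℝ (Fin d) := fun i =>
    gradient U (midpoint U η K i x (p.1 i)) - gradient U (midpoint U η K i y (p.1 i)) with hGh
  have e : ∀ H : Fin K → ℝ, step U η K x (H, p) - step U η K y (H, p)
      = (x - y - η • G) + η • ∑ i, H i • (G - Gh i) := by
    intro H
    have : ∑ i, H i • (G - Gh i)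
        = (∑ i, H i • (gradient U x - gradient U (midpoint U η K i x (p.1 i))))
          - ∑ i, H i • (gradient U y - gradient U (midpoint U η K i y (p.1 i))) := by
      rw [← Finset.sum_sub_distrib]
      refine Finset.sum_congr rfl fun i _ => ?_
      rw [← smul_sub]
      exact congrArg _ (sub_sub_sub_comm _ _ _ _)
    rw [this, hG]
    simp only [step, smul_sub]
    abel
  simp_rw [e]
  refine (lintegral_selectorLaw_le hK _ _ η).trans (ENNReal.ofReal_le_ofReal ?_)
  refine average_le hK fun i => ?_
  have e2 : x - y - η • G + η • (G - Gh i) = x - y - η • Gh i := by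
    rw [smul_sub η G (Gh i), sub_add_sub_cancel]
  have e3 : midpoint U η K i x (p.1 i) - midpoint U η K i y (p.1 i)
      = x - y - ((i : ℝ) * η / K) • G := by
    simp only [midpoint, hG, smul_sub]
    abel
  rw [e2]
  refine midpoint_contraction hm (abs_nonneg L) hη.le (time_nonneg hη.le i) (time_le hη.le i) hηL
    hηm (hU.norm_gradient_sub_le hm x y) ?_ ?_
  · rw [← e3]; exact hU.norm_gradient_sub_le hm _ _
  · rw [← e3]; exact hU.inner_gradient_sub_ge _ _

/-- The average over `i` of the variances `2 i η / K` of the midpoint noises; this is where the factor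
`1 - 1 / K` comes from. -/
theorem sum_two_mul_time (hK : 1 ≤ K) :
    1 / (K : ℝ) * ∑ i : Fin K, 2 * (i : ℝ) * η / K = η * (1 - 1 / K) := by
  have hK0 : (K : ℝ) ≠ 0 := by positivity
  have h1 : (∑ i : Fin K, (i : ℝ)) * 2 = K * (K - 1) := by
    have := Finset.sum_range_id_mul_two K
    rw [Fin.sum_univ_eq_sum_range (fun i => (i : ℝ)) K]
    have h2 : ((∑ i ∈ Finset.range K, i : ℕ) : ℝ) * 2 = (K : ℝ) * ((K - 1 : ℕ) : ℝ) := by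
      exact_mod_cast this
    rw [Nat.cast_sub hK] at h2
    push_cast at h2
    exact h2
  have h2 : ∑ i : Fin K, 2 * (i : ℝ) * η / K = (∑ i : Fin K, (i : ℝ)) * 2 * (η / K) := by
    rw [Finset.sum_mul, Finset.sum_mul]
    exact Finset.sum_congr rfl fun i _ => by ring
  rw [h2, h1]
  field_simp

/-- The geometric drift condition for the squared norm. -/
theorem lintegral_norm_step_sq_le (hU : IsPotential m L U) (hK : 1 ≤ K) (hm : 0 < m)
    (hη : 0 < η) (hη1 : η ≤ 1) (hηL : η * (1 + 2 * L ^ 2 + 3 * L ^ 4) ≤ m)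
    (x : EuclideanSpace ℝ (Fin d)) :
    ∫⁻ w, ENNReal.ofReal (‖step U η K x w‖ ^ 2) ∂noiseLaw d K
      ≤ ENNReal.ofReal ((1 - η * m) * ‖x‖ ^ 2 + (1 - (1 - η * m)) *
        (d / m * (2 + 4 * η ^ 2 * L ^ 2 * (2 - 1 / K) + L ^ 2 * (1 - 1 / K)))) := by
  have hK0 : (0 : ℝ) < K := by positivity
  have hmx := measurable_step_right U η K x
  have hgm := measurable_gradient U
  set g := gradient U x with hg
  set v := x - η • g with hv
  set R : Fin K → EuclideanSpace ℝ (Fin d) → EuclideanSpace ℝ (Fin d) := fun i z =>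
    g - gradient U (midpoint U η K i x z) with hR
  have hRm : ∀ i, Measurable (R i) := by
    intro i
    simp only [hR, midpoint]
    fun_prop
  have hs : √(2 * η) ^ 2 = 2 * η := Real.sq_sqrt (by positivity)
  have hRle : ∀ i z, ‖R i z‖ ^ 2
      ≤ L ^ 2 * ‖((i : ℝ) * η / K) • g + (-√(2 * i * η / K)) • z‖ ^ 2 := by
    intro i z
    have h1 := hU.norm_gradient_sub_le hm x (midpoint U η K i x z)
    have e : x - midpoint U η K i x z = ((i : ℝ) * η / K) • g + (-√(2 * i * η / K)) • z := by
      simp only [midpoint, neg_smul, hg]; abel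
    rw [e] at h1
    have h2 := pow_le_pow_left₀ (norm_nonneg _) h1 2
    rwa [mul_pow, sq_abs] at h2
  -- the left-hand side is the contribution of the `i`-th midpoint to the conditional second moment
  -- given the midpoint noise; Young's inequality with weight `η ^ 2` on `‖v‖ ^ 2` leaves the
  -- coefficient `1` in front of `‖R i z‖ ^ 2` to leading order
  have hinner : ∀ i z, ‖v + η • R i z‖ ^ 2 + 2 * η * d + η ^ 2 * ‖R i z‖ ^ 2
      ≤ (1 + η ^ 2) * ‖v‖ ^ 2 + 2 * η * d + (1 + 2 * η ^ 2) * (L ^ 2 *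
          ‖((i : ℝ) * η / K) • g + (-√(2 * i * η / K)) • z‖ ^ 2) := by
    intro i z
    have h1 := mul_le_mul_of_nonneg_left (hRle i z) (show 0 ≤ 1 + 2 * η ^ 2 by positivity)
    have h2 : ‖v + η • R i z‖ ^ 2 ≤ (1 + η ^ 2) * ‖v‖ ^ 2 + (1 + η ^ 2) * ‖R i z‖ ^ 2 := by
      have h3 : 0 ≤ ‖η • v - R i z‖ ^ 2 := by positivity
      rw [norm_sub_sq_real, inner_smul_left, norm_smul, mul_pow, Real.norm_eq_abs, sq_abs] at h3
      rw [norm_add_sq_real, inner_smul_right, norm_smul, mul_pow, Real.norm_eq_abs, sq_abs]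
      simp only [conj_trivial] at h3
      linarith
    linarith
  have hξ : ∀ ζ : Fin K → EuclideanSpace ℝ (Fin d),
      ∫⁻ ξ, ∫⁻ H, ENNReal.ofReal (‖step U η K x (H, ζ, ξ)‖ ^ 2) ∂selectorLaw K
        ∂stdGaussian (EuclideanSpace ℝ (Fin d))
      ≤ ENNReal.ofReal (1 / K * ∑ i : Fin K, ((1 + η ^ 2) * ‖v‖ ^ 2 + 2 * η * d
        + (1 + 2 * η ^ 2) * (L ^ 2 *
          ‖((i : ℝ) * η / K) • g + (-√(2 * i * η / K)) • ζ i‖ ^ 2))) := by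
    intro ζ
    have e : ∀ H ξ, step U η K x (H, ζ, ξ)
        = (v + √(2 * η) • ξ) + η • ∑ i, H i • R i (ζ i) := by
      intro H ξ
      simp only [step, hv, hR, hg]
      abel
    have ec : ∀ i ξ, v + √(2 * η) • ξ + η • R i (ζ i) = v + η • R i (ζ i) + √(2 * η) • ξ :=
      fun i ξ => add_right_comm _ _ _
    have hi : ∀ i, Integrable (fun ξ => ‖v + √(2 * η) • ξ + η • R i (ζ i)‖ ^ 2
        + η ^ 2 * ‖R i (ζ i)‖ ^ 2) (stdGaussian (EuclideanSpace ℝ (Fin d))) := by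
      intro i
      have := integrable_norm_add_smul_sq_stdGaussian (v + η • R i (ζ i)) (√(2 * η))
      simp_rw [ec]
      exact this.add (integrable_const _)
    calc _ ≤ ∫⁻ ξ, ENNReal.ofReal (1 / K * ∑ i, (‖v + √(2 * η) • ξ + η • R i (ζ i)‖ ^ 2
            + η ^ 2 * ‖R i (ζ i)‖ ^ 2)) ∂stdGaussian (EuclideanSpace ℝ (Fin d)) := by
          refine lintegral_mono fun ξ => ?_
          simp_rw [e]
          exact lintegral_selectorLaw_le hK _ _ η
      _ = ENNReal.ofReal (∫ ξ, 1 / K * ∑ i, (‖v + √(2 * η) • ξ + η • R i (ζ i)‖ ^ 2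
            + η ^ 2 * ‖R i (ζ i)‖ ^ 2) ∂stdGaussian (EuclideanSpace ℝ (Fin d))) :=
          (ofReal_integral_eq_lintegral_ofReal
            ((integrable_finsetSum _ fun i _ => hi i).const_mul _)
            (ae_of_all _ fun ξ => by positivity)).symm
      _ ≤ _ := by
          refine ENNReal.ofReal_le_ofReal ?_
          rw [integral_const_mul, integral_finsetSum _ fun i _ => hi i]
          refine mul_le_mul_of_nonneg_left (Finset.sum_le_sum fun i _ => ?_) (by positivity)
          refine le_trans (le_of_eq ?_) (hinner i (ζ i))
          have h1 := integrable_norm_add_smul_sq_stdGaussian (v + η • R i (ζ i)) (√(2 * η))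
          simp_rw [ec]
          rw [integral_add h1 (integrable_const _), integral_norm_add_smul_sq_stdGaussian, hs]
          simp
  have hgi : ∀ i : Fin K, Integrable (fun z : EuclideanSpace ℝ (Fin d) => (1 + η ^ 2) * ‖v‖ ^ 2
      + 2 * η * d + (1 + 2 * η ^ 2) * (L ^ 2 *
        ‖((i : ℝ) * η / K) • g + (-√(2 * i * η / K)) • z‖ ^ 2))
      (stdGaussian (EuclideanSpace ℝ (Fin d))) := fun i =>
    (integrable_const _).add
      (((integrable_norm_add_smul_sq_stdGaussian _ _).const_mul _).const_mul _)
  have hgi' := fun i : Fin K => integrable_comp_eval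
    (μ := fun _ : Fin K => stdGaussian (EuclideanSpace ℝ (Fin d))) (i := i) (hgi i)
  have hgint : ∀ i : Fin K, ∫ z : EuclideanSpace ℝ (Fin d), ((1 + η ^ 2) * ‖v‖ ^ 2
      + 2 * η * d + (1 + 2 * η ^ 2) * (L ^ 2 *
        ‖((i : ℝ) * η / K) • g + (-√(2 * i * η / K)) • z‖ ^ 2))
      ∂(stdGaussian (EuclideanSpace ℝ (Fin d)))
      = (1 + η ^ 2) * ‖v‖ ^ 2 + 2 * η * d + (1 + 2 * η ^ 2) * (L ^ 2 *
        (‖((i : ℝ) * η / K) • g‖ ^ 2 + 2 * i * η / K * d)) := by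
    intro i
    rw [integral_add (integrable_const _)
      (((integrable_norm_add_smul_sq_stdGaussian _ _).const_mul _).const_mul _),
      integral_const_mul, integral_const_mul, integral_norm_add_smul_sq_stdGaussian, neg_sq,
      Real.sq_sqrt (by positivity)]
    simp
  have hmeas : Measurable fun w : Noise d K => ENNReal.ofReal (‖step U η K x w‖ ^ 2) := by fun_prop
  rw [lintegral_noiseLaw hmeas, lintegral_prod _ (Measurable.lintegral_prod_left'
    (f := fun q : (Fin K → ℝ) × _ => ENNReal.ofReal (‖step U η K x q‖ ^ 2)) hmeas).aemeasurable]
  refine (lintegral_mono hξ).trans ?_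
  rw [← ofReal_integral_eq_lintegral_ofReal
    ((integrable_finsetSum _ fun i _ => hgi' i).const_mul _) (ae_of_all _ fun ζ => by positivity),
    integral_const_mul, integral_finsetSum _ fun i _ => hgi' i]
  refine ENNReal.ofReal_le_ofReal ?_
  have hcomp := fun i : Fin K => integral_comp_eval
    (μ := fun _ : Fin K => stdGaussian (EuclideanSpace ℝ (Fin d))) (i := i) (hgi i).1
  simp_rw [hcomp, hgint]
  have hgx : ‖g‖ ^ 2 ≤ L ^ 2 * ‖x‖ ^ 2 := by
    have h1 := hU.norm_gradient_sub_le hm x 0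
    rw [hU.gradient_zero, sub_zero, sub_zero] at h1
    have h2 := pow_le_pow_left₀ (norm_nonneg _) h1 2
    rwa [mul_pow, sq_abs] at h2
  have hvx : ‖v‖ ^ 2 ≤ (1 - 2 * η * m + η ^ 2 * L ^ 2) * ‖x‖ ^ 2 := by
    have h1 := hU.inner_gradient_sub_ge x 0
    rw [hU.gradient_zero, sub_zero, sub_zero, ← hg] at h1
    rw [hv, norm_sub_sq_real, inner_smul_right, norm_smul, mul_pow, Real.norm_eq_abs, sq_abs]
    have h2 := mul_le_mul_of_nonneg_left hgx (sq_nonneg η)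
    have h3 := mul_le_mul_of_nonneg_left h1 (show 0 ≤ 2 * η by positivity)
    linarith
  have htg : ∀ i : Fin K, ‖((i : ℝ) * η / K) • g‖ ^ 2 ≤ η ^ 2 * (L ^ 2 * ‖x‖ ^ 2) := by
    intro i
    rw [norm_smul, mul_pow, Real.norm_of_nonneg (time_nonneg hη.le i)]
    have h1 := time_le hη.le i
    have h2 := time_nonneg hη.le i
    gcongr
  have hsum : 1 / (K : ℝ) * ∑ i : Fin K, ((1 + η ^ 2) * ‖v‖ ^ 2 + 2 * η * d
        + (1 + 2 * η ^ 2) * (L ^ 2 * (‖((i : ℝ) * η / K) • g‖ ^ 2 + 2 * i * η / K * d)))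
      ≤ (1 + η ^ 2) * ‖v‖ ^ 2 + 2 * η * d + (1 + 2 * η ^ 2) * (L ^ 2 *
        (η ^ 2 * (L ^ 2 * ‖x‖ ^ 2) + η * (1 - 1 / K) * d)) := by
    calc _ ≤ 1 / (K : ℝ) * ∑ i : Fin K, ((1 + η ^ 2) * ‖v‖ ^ 2 + 2 * η * d
        + (1 + 2 * η ^ 2) * (L ^ 2 * (η ^ 2 * (L ^ 2 * ‖x‖ ^ 2) + 2 * i * η / K * d))) := by
          gcongr with i
          exact htg i
      _ = _ := by
          rw [← sum_two_mul_time hK]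
          simp only [Finset.sum_add_distrib, ← Finset.mul_sum, ← Finset.sum_mul, Finset.sum_const,
            Finset.card_univ, Fintype.card_fin, nsmul_eq_mul]
          field_simp
  refine hsum.trans ?_
  have hx := sq_nonneg ‖x‖
  -- of the gain `2 η m` one half absorbs all terms of order `η ^ 2`
  have hcoef : (1 + η ^ 2) * (1 - 2 * η * m + η ^ 2 * L ^ 2) + (1 + 2 * η ^ 2) * (L ^ 4 * η ^ 2)
      ≤ 1 - η * m := by
    have h1 : η ^ 2 ≤ 1 := pow_le_one₀ hη.le hη1
    have h2 : η ^ 2 * (η ^ 2 * L ^ 2) ≤ 1 * (η ^ 2 * L ^ 2) := by gcongr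
    have h3 : η ^ 2 * (L ^ 4 * η ^ 2) ≤ 1 * (L ^ 4 * η ^ 2) := by gcongr
    have h4 := mul_le_mul_of_nonneg_left hηL hη.le
    have h5 : 0 ≤ η ^ 2 * (η * m) := by positivity
    linarith
  have h1 := mul_le_mul_of_nonneg_left hvx (show 0 ≤ 1 + η ^ 2 by positivity)
  have h2 := mul_le_mul_of_nonneg_right hcoef hx
  have hK1 : 1 / (K : ℝ) ≤ 1 := by
    rw [div_le_one hK0]; exact_mod_cast hK
  have hconst : 2 * η * d + (1 + 2 * η ^ 2) * (L ^ 2 * (η * (1 - 1 / K) * d))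
      ≤ (1 - (1 - η * m)) *
        (d / m * (2 + 4 * η ^ 2 * L ^ 2 * (2 - 1 / K) + L ^ 2 * (1 - 1 / K))) := by
    have e : (1 - (1 - η * m)) *
        (d / m * (2 + 4 * η ^ 2 * L ^ 2 * (2 - 1 / K) + L ^ 2 * (1 - 1 / K)))
        = η * d * (2 + 4 * η ^ 2 * L ^ 2 * (2 - 1 / K) + L ^ 2 * (1 - 1 / K)) := by
      field_simp
      ring
    rw [e]
    have h3 : 0 ≤ η * d * (η ^ 2 * L ^ 2) * (2 * (1 - 1 / K) + 4) := by
      have : 0 ≤ 1 - 1 / (K : ℝ) := by linarith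
      positivity
    linarith
  linarith

end OneStep

/-! ### The transition kernel is contracting and smoothing -/

section KernelEstimates

variable {d K : ℕ} {m L η : ℝ} {U : EuclideanSpace ℝ (Fin d) → ℝ}

theorem kernel_apply (U : EuclideanSpace ℝ (Fin d) → ℝ) (η : ℝ) (K : ℕ)
    (x : EuclideanSpace ℝ (Fin d)) :
    kernel U η K x = (noiseLaw d K).map (step U η K x) := rfl

instance isMarkovKernel_kernel (U : EuclideanSpace ℝ (Fin d) → ℝ) (η : ℝ) (K : ℕ) :
    IsMarkovKernel (kernel U η K) :=
  ⟨fun x => Measure.isProbabilityMeasure_map (measurable_step_right U η K x).aemeasurable⟩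

theorem integral_kernel (x : EuclideanSpace ℝ (Fin d)) {f : EuclideanSpace ℝ (Fin d) → ℝ}
    (hf : Measurable f) :
    ∫ z, f z ∂kernel U η K x = ∫ w, f (step U η K x w) ∂noiseLaw d K := by
  rw [kernel_apply, integral_map (measurable_step_right U η K x).aemeasurable
    hf.aestronglyMeasurable]

/-- Conditionally on the selectors and the midpoint noise, one step is a Gaussian smoothing, so
that the transition probabilities are controlled by the mean distance of two coupled steps. -/
theorem abs_integral_kernel_sub_le (hη : 0 < η) {f : EuclideanSpace ℝ (Fin d) → ℝ}
    (hf : Measurable f) (h0 : ∀ z, 0 ≤ f z) (h1 : ∀ z, f z ≤ 1) (x y : EuclideanSpace ℝ (Fin d))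
    (hi : Integrable (fun w => ‖step U η K x w - step U η K y w‖) (noiseLaw d K)) :
    |∫ z, f z ∂kernel U η K x - ∫ z, f z ∂kernel U η K y|
      ≤ 2 / √(2 * η) * ∫ w, ‖step U η K x w - step U η K y w‖ ∂noiseLaw d K := by
  -- regroup the noise so that the Gaussian increment of the step is integrated first
  have hmp : MeasurePreserving (MeasurableEquiv.prodAssoc :
      ((Fin K → ℝ) × (Fin K → EuclideanSpace ℝ (Fin d))) × EuclideanSpace ℝ (Fin d) ≃ᵐ _)
      (((selectorLaw K).prod
        (Measure.pi fun _ : Fin K => stdGaussian (EuclideanSpace ℝ (Fin d)))).prod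
          (stdGaussian (EuclideanSpace ℝ (Fin d)))) (noiseLaw d K) :=
    measurePreserving_prodAssoc _ _ _
  set a : EuclideanSpace ℝ (Fin d) → (Fin K → ℝ) × (Fin K → EuclideanSpace ℝ (Fin d)) →
      EuclideanSpace ℝ (Fin d) := fun x q => x - η • gradient U x
    + η • ∑ i : Fin K, q.1 i • (gradient U x - gradient U (midpoint U η K i x (q.2 i))) with ha
  have hstep : ∀ x q, step U η K x (MeasurableEquiv.prodAssoc q) = a x q.1 + √(2 * η) • q.2 :=
    fun _ _ => rfl
  have hI : ∀ x, Integrable (fun q => f (step U η K x (MeasurableEquiv.prodAssoc q)))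
      (((selectorLaw K).prod
        (Measure.pi fun _ : Fin K => stdGaussian (EuclideanSpace ℝ (Fin d)))).prod
          (stdGaussian (EuclideanSpace ℝ (Fin d)))) := fun x =>
    Integrable.of_bound (hf.comp ((measurable_step_right U η K x).comp
      MeasurableEquiv.prodAssoc.measurable)).aestronglyMeasurable 1 (ae_of_all _ fun q => by
        rw [Real.norm_of_nonneg (h0 _)]; exact h1 _)
  have hDi : Integrable (fun q => ‖step U η K x (MeasurableEquiv.prodAssoc q)
      - step U η K y (MeasurableEquiv.prodAssoc q)‖) _ := hmp.integrable_comp_of_integrable hi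
  rw [integral_kernel x hf, integral_kernel y hf,
    ← hmp.integral_comp MeasurableEquiv.prodAssoc.measurableEmbedding,
    ← hmp.integral_comp MeasurableEquiv.prodAssoc.measurableEmbedding,
    ← hmp.integral_comp MeasurableEquiv.prodAssoc.measurableEmbedding,
    integral_prod _ (hI x), integral_prod _ (hI y), integral_prod _ hDi,
    ← integral_sub (hI x).integral_prod_left (hI y).integral_prod_left, ← integral_const_mul,
    ← Real.norm_eq_abs]
  refine norm_integral_le_of_norm_le (hDi.integral_prod_left.const_mul _)
    (ae_of_all _ fun q => ?_)
  simp only [hstep, add_sub_add_right_eq_sub]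
  rw [integral_const, probReal_univ, one_smul]
  exact abs_integral_stdGaussian_smul_sub_le hf h0 h1 (by positivity) _ _

theorem isContractiveSmoothing_kernel (hU : IsPotential m L U) (hK : 1 ≤ K) (hm : 0 < m)
    (hη : 0 < η) (hη1 : η ≤ 1) (hηL : η * |L| ≤ 1)
    (hηm : η * (4 * m * |L| + 17 * |L| ^ 2) ≤ m) (hηm1 : η * m < 1)
    (hηd : η * (1 + 2 * L ^ 2 + 3 * L ^ 4) ≤ m) :
    IsContractiveSmoothing (kernel U η K) √(1 - η * m) (2 / √(2 * η)) := by
  have hρ0 : 0 ≤ 1 - η * m := by linarith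
  have hρ1 : √(1 - η * m) < 1 := by
    rw [Real.sqrt_lt' one_pos]
    nlinarith [mul_pos hη hm]
  have hcoup : ∀ x y, Integrable (fun w => ‖step U η K x w - step U η K y w‖) (noiseLaw d K) ∧
      ∫ w, ‖step U η K x w - step U η K y w‖ ∂noiseLaw d K ≤ √(1 - η * m) * ‖x - y‖ := by
    intro x y
    have hmx := measurable_step_right U η K x
    have hmy := measurable_step_right U η K y
    have h := lintegral_norm_step_sub_sq_le hU hK hm hη hηL hηm x y
    rw [← Real.sq_sqrt hρ0, ← mul_pow] at h
    have h2 := integrable_and_integral_le_of_lintegral_sq_le (hmx.sub hmy).norm (by positivity) h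
    exact ⟨h2.1, h2.2.2.2⟩
  refine ⟨Real.sqrt_nonneg _, hρ1, by positivity, ?_, ?_, ?_⟩
  · intro f c hf h0 h1 hc hLip x y
    have hI : ∀ x, Integrable (fun w => f (step U η K x w)) (noiseLaw d K) := fun x =>
      Integrable.of_bound (hf.comp (measurable_step_right U η K x)).aestronglyMeasurable 1
        (ae_of_all _ fun q => by rw [Real.norm_of_nonneg (h0 _)]; exact h1 _)
    rw [integral_kernel x hf, integral_kernel y hf, ← integral_sub (hI x) (hI y), mul_assoc,
      ← Real.norm_eq_abs]
    refine (norm_integral_le_of_norm_le ((hcoup x y).1.const_mul c)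
      (ae_of_all _ fun w => hLip _ _)).trans ?_
    rw [integral_const_mul]
    exact mul_le_mul_of_nonneg_left (hcoup x y).2 hc
  · intro A hA x y
    have h := abs_integral_kernel_sub_le (U := U) (K := K) hη
      (measurable_const.indicator hA : Measurable (A.indicator fun _ => (1 : ℝ)))
      (fun z => Set.indicator_nonneg (fun _ _ => zero_le_one) z)
      (fun z => Set.indicator_le_self' (fun _ _ => zero_le_one) z) x y (hcoup x y).1
    rw [integral_indicator_const _ hA, integral_indicator_const _ hA, smul_eq_mul, smul_eq_mul,
      mul_one, mul_one] at h
    refine h.trans (mul_le_mul_of_nonneg_left ((hcoup x y).2.trans ?_) (by positivity))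
    exact mul_le_of_le_one_left (norm_nonneg _) hρ1.le
  · have h := lintegral_norm_step_sq_le hU hK hm hη hη1 hηd (0 : EuclideanSpace ℝ (Fin d))
    have hm0 := measurable_step_right U η K (0 : EuclideanSpace ℝ (Fin d))
    have hB : 0 ≤ (1 - η * m) * ‖(0 : EuclideanSpace ℝ (Fin d))‖ ^ 2 + (1 - (1 - η * m)) *
        (d / m * (2 + 4 * η ^ 2 * L ^ 2 * (2 - 1 / K) + L ^ 2 * (1 - 1 / K))) := by
      have hK1 : 1 / (K : ℝ) ≤ 1 := by
        rw [div_le_one (by positivity)]; exact_mod_cast hK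
      have h1 : 0 ≤ 2 - 1 / (K : ℝ) := by linarith
      have h2 : 0 ≤ 1 - 1 / (K : ℝ) := by linarith
      have h3 : 0 ≤ 1 - (1 - η * m) := by nlinarith [mul_pos hη hm]
      positivity
    rw [← Real.sq_sqrt hB] at h
    have h2 := integrable_and_integral_le_of_lintegral_sq_le hm0.norm (by positivity) h
    rw [kernel_apply, integrable_map_measure (by fun_prop) hm0.aemeasurable]
    exact h2.1

end KernelEstimates

/-! ### The law of the chain -/

section Chains

theorem measurable_step_comp {d K : ℕ} {η : ℝ} {U : EuclideanSpace ℝ (Fin d) → ℝ} {Ω : Type*}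
    {mΩ : MeasurableSpace Ω} {f : Ω → EuclideanSpace ℝ (Fin d)} {g : Ω → Noise d K}
    (hf : Measurable f) (hg : Measurable g) : Measurable fun ω => step U η K (f ω) (g ω) := by
  have h := Measurable.comp (measurable_step U η K) (hf.prodMk hg)
  exact h

variable {d K : ℕ} {η : ℝ} {U : EuclideanSpace ℝ (Fin d) → ℝ} {x : EuclideanSpace ℝ (Fin d)}
  {Ω : Type*} [MeasurableSpace Ω] {P : Measure Ω} {W : ℕ → Ω → Noise d K}
  {X : ℕ → Ω → EuclideanSpace ℝ (Fin d)}

/-- The state at time `n` is a measurable function of the noise before time `n`. -/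
theorem IsChain.measurable_past (h : IsChain U η K x P W X) (n : ℕ) :
    Measurable[⨆ i ∈ Set.Iio n, MeasurableSpace.comap (W i) inferInstance] (X n) := by
  induction n with
  | zero =>
    rw [show X 0 = fun _ => x from funext h.init]
    exact measurable_const
  | succ n ih =>
    rw [show X (n + 1) = fun ω => step U η K (X n ω) (W n ω) from funext (h.step_eq n)]
    have hX : Measurable[⨆ i ∈ Set.Iio (n + 1), MeasurableSpace.comap (W i) inferInstance] (X n) :=
      ih.mono (biSup_mono fun i hi => (Set.mem_Iio.1 hi).trans n.lt_succ_self) le_rfl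
    have hW : Measurable[⨆ i ∈ Set.Iio (n + 1), MeasurableSpace.comap (W i) inferInstance] (W n) :=
      (comap_measurable (W n)).mono
        (le_biSup (fun i => MeasurableSpace.comap (W i) inferInstance) n.lt_succ_self) le_rfl
    exact measurable_step_comp hX hW

theorem IsChain.measurable_state (h : IsChain U η K x P W X) (n : ℕ) : Measurable (X n) :=
  (h.measurable_past n).mono
    (iSup₂_le fun i _ => (h.measurable_noise i).comap_le) le_rfl

theorem IsChain.indepFun_state_noise (h : IsChain U η K x P W X) (n : ℕ) :
    IndepFun (X n) (W n) P := by
  have hind := indep_iSup_of_disjoint (fun i => (h.measurable_noise i).comap_le)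
    h.indep_noise (S := Set.Iio n) (T := {n}) (by simp)
  rw [IndepFun_iff_Indep]
  exact indep_of_indep_of_le_left (indep_of_indep_of_le_right hind (by simp))
    (h.measurable_past n).comap_le

theorem IsChain.map_eq_pow [IsProbabilityMeasure P] (h : IsChain U η K x P W X) (n : ℕ) :
    P.map (X n) = (kernel U η K ^ n) x := by
  induction n with
  | zero =>
    rw [show X 0 = fun _ => x from funext h.init, Measure.map_const, measure_univ, one_smul,
      pow_zero]
    exact (Kernel.id_apply x).symm
  | succ n ih =>
    have hXn := h.measurable_state n
    have hWn := h.measurable_noise n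
    have : IsProbabilityMeasure (P.map (X n)) := Measure.isProbabilityMeasure_map hXn.aemeasurable
    rw [pow_succ_apply_eq_bind, ← ih]
    rw [show X (n + 1) = (fun p : _ × Noise d K => step U η K p.1 p.2) ∘ (fun ω => (X n ω, W n ω))
      from funext (h.step_eq n), ← Measure.map_map (measurable_step U η K) (hXn.prodMk hWn),
      (indepFun_iff_map_prod_eq_prod_map_map hXn.aemeasurable hWn.aemeasurable).1
        (h.indepFun_state_noise n), h.law_noise]
    ext A hA
    rw [Measure.map_apply (measurable_step U η K) hA,
      Measure.prod_apply (measurable_step U η K hA), Measure.bind_apply hA (Kernel.aemeasurable _)]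
    refine lintegral_congr fun z => ?_
    rw [kernel_apply, Measure.map_apply (measurable_step_right U η K z) hA]
    rfl

end Chains

/-! ### Total variation distance -/

section TotalVariation

variable {E : Type*} [MeasurableSpace E]

theorem dTV_nonneg (μ ν : Measure E) : 0 ≤ dTV μ ν :=
  Real.iSup_nonneg fun _ => abs_nonneg _

theorem dTV_le {μ ν : Measure E} {b : ℝ}
    (h : ∀ A, MeasurableSet A → |μ.real A - ν.real A| ≤ b) : dTV μ ν ≤ b :=
  have : Nonempty {A : Set E // MeasurableSet A} := ⟨⟨∅, .empty⟩⟩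
  ciSup_le fun A => h A.1 A.2

end TotalVariation

end PRLMC

/-! ### Stationary distribution and geometric convergence -/

theorem theorem2p1 (m L : ℝ) (hm : 0 < m) :
    ∃ η₀ : ℝ, 0 < η₀ ∧ η₀ < 1 ∧
      ∀ (d K : ℕ), 1 ≤ K →
      ∀ U : EuclideanSpace ℝ (Fin d) → ℝ, PRLMC.IsPotential m L U →
      ∀ η : ℝ, 0 < η → η < η₀ →
      ∃ π : Measure (EuclideanSpace ℝ (Fin d)),
        -- `π` is the unique stationary distribution
        IsProbabilityMeasure π ∧ (PRLMC.kernel U η K).Invariant π ∧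
        (∀ ν : Measure (EuclideanSpace ℝ (Fin d)),
          IsProbabilityMeasure ν → (PRLMC.kernel U η K).Invariant ν → ν = π) ∧
        -- second moment bound
        Integrable (fun x => ‖x‖ ^ 2) π ∧
        ∫ x, ‖x‖ ^ 2 ∂π ≤
          d / m * (2 + 4 * η ^ 2 * L ^ 2 * (2 - 1 / K) + L ^ 2 * (1 - 1 / K)) ∧
        -- geometric convergence in total variation from every starting point
        ∃ δ : ℝ, 1 < δ ∧
          ∀ (x : EuclideanSpace ℝ (Fin d)) (Ω : Type*) [MeasurableSpace Ω] (P : Measure Ω)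
            [IsProbabilityMeasure P] (W : ℕ → Ω → PRLMC.Noise d K)
            (X : ℕ → Ω → EuclideanSpace ℝ (Fin d)), PRLMC.IsChain U η K x P W X →
            Summable (fun n : ℕ => δ ^ n * PRLMC.dTV (P.map (X n)) π) ∧
            (fun n : ℕ => PRLMC.dTV (P.map (X n)) π) =o[atTop] (fun n : ℕ => (δ ^ n)⁻¹) := by
  -- `S` dominates every coefficient that `η` has to beat, so that `η < m / S` is small enough
  set S := 1 + m ^ 2 + 4 * m * |L| + 17 * L ^ 2 + 3 * L ^ 4 with hS
  have hL := abs_nonneg L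
  have hmL : 0 ≤ m * |L| := by positivity
  have hL2 := sq_nonneg L
  have hL4 : 0 ≤ L ^ 4 := by positivity
  have hS0 : 0 < S := by positivity
  refine ⟨min (1 / 2) (m / S), by positivity, (min_le_left _ _).trans_lt (by norm_num), ?_⟩
  intro d K hK U hU η hη hηlt
  have hη1 : η ≤ 1 := (hηlt.le.trans (min_le_left _ _)).trans (by norm_num)
  have hηS : η * S ≤ m := by
    have := hηlt.le.trans (min_le_right _ _)
    rwa [le_div_iff₀ hS0] at this
  have hsub : ∀ T, T ≤ S → η * T ≤ m := fun T hT =>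
    (mul_le_mul_of_nonneg_left hT hη.le).trans hηS
  have hηL : η * |L| ≤ 1 := by
    have := hsub (m * |L|) (by rw [hS]; nlinarith)
    nlinarith
  have hηm : η * (4 * m * |L| + 17 * |L| ^ 2) ≤ m := by
    refine hsub _ ?_
    rw [sq_abs, hS]; nlinarith
  have hηm1 : η * m < 1 := by
    have h1 := hsub (1 + m ^ 2) (by rw [hS]; nlinarith)
    nlinarith
  have hηd : η * (1 + 2 * L ^ 2 + 3 * L ^ 4) ≤ m := by
    refine hsub _ ?_
    rw [hS]; nlinarith
  have hC := PRLMC.isContractiveSmoothing_kernel (K := K) hU hK hm hη hη1 hηL hηm hηm1 hηd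
  obtain ⟨π, hπ, hinv⟩ := hC.exists_invariant
  set B : ℝ := d / m * (2 + 4 * η ^ 2 * L ^ 2 * (2 - 1 / K) + L ^ 2 * (1 - 1 / K)) with hB
  have hB0 : 0 ≤ B := by
    have hK1 : 1 / (K : ℝ) ≤ 1 := by
      rw [div_le_one (by positivity)]; exact_mod_cast hK
    have h1 : 0 ≤ 2 - 1 / (K : ℝ) := by linarith
    have h2 : 0 ≤ 1 - 1 / (K : ℝ) := by linarith
    positivity
  have hηm0 : 0 < η * m := by positivity
  have hmom := hC.lintegral_norm_sq_le_of_drift hinv (a := 1 - η * m) (B := B) (by linarith)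
    (by linarith) hB0 fun x => by
      rw [PRLMC.kernel_apply, lintegral_map (by fun_prop) (PRLMC.measurable_step_right U η K x)]
      exact PRLMC.lintegral_norm_step_sq_le hU hK hm hη hη1 hηd x
  rw [← Real.sq_sqrt hB0] at hmom
  obtain ⟨hi1, hi2, hle, -⟩ := PRLMC.integrable_and_integral_le_of_lintegral_sq_le
    (P := π) (f := fun x => ‖x‖) (by fun_prop) (Real.sqrt_nonneg B) hmom
  rw [Real.sq_sqrt hB0] at hle
  refine ⟨π, hπ, hinv, fun ν hν hνinv => hC.eq_of_invariant hνinv hinv, hi2, hle, ?_⟩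
  set ρ := √(1 - η * m) with hρ
  have hρ0 : 0 < ρ := Real.sqrt_pos.2 (by linarith)
  have hρ1 : ρ < 1 := hC.lt_one
  -- any `δ` strictly between `1` and `ρ⁻¹` will do
  obtain ⟨δ, hδ1, hδ⟩ := exists_between ((one_lt_inv₀ hρ0).2 hρ1)
  have hδρ : δ * ρ < 1 := by
    rwa [← lt_inv_mul_iff₀' hρ0, mul_one]
  refine ⟨δ, hδ1, fun x Ω _ P _ W X hX => ?_⟩
  have hδ0 : 0 < δ := by linarith
  set D := (2 / √(2 * η)) * ∫ y, ‖x - y‖ ∂π with hD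
  have hD0 : 0 ≤ D := by positivity
  have htv : ∀ n, PRLMC.dTV (P.map (X n)) π ≤ (1 + D / ρ) * ρ ^ n := by
    intro n
    refine PRLMC.dTV_le fun A hA => ?_
    rw [hX.map_eq_pow]
    -- the smoothing estimate needs one step, so time `0` is covered by the trivial bound `1`
    cases n with
    | zero =>
      have a1 : ((PRLMC.kernel U η K ^ 0) x).real A ≤ 1 := measureReal_le_one
      have a2 : π.real A ≤ 1 := measureReal_le_one
      have a3 : 0 ≤ ((PRLMC.kernel U η K ^ 0) x).real A := measureReal_nonneg
      have a4 : 0 ≤ π.real A := measureReal_nonneg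
      have a5 : 0 ≤ D / ρ := by positivity
      rw [pow_zero ρ, mul_one, abs_le]
      constructor <;> linarith
    | succ n =>
      have h := hC.abs_pow_sub_bind_le n hA x π hi1
      rw [(PRLMC.invariant_pow hinv (n + 1)).def] at h
      refine h.trans ?_
      have e : (1 + D / ρ) * ρ ^ (n + 1) = ρ ^ (n + 1) + D * ρ ^ n := by
        field_simp
        ring
      rw [e, hD]
      have : 0 ≤ ρ ^ (n + 1) := by positivity
      linarith
  have hsum : Summable (fun n : ℕ => δ ^ n * PRLMC.dTV (P.map (X n)) π) := by
    refine Summable.of_nonneg_of_le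
      (fun n => mul_nonneg (by positivity) (PRLMC.dTV_nonneg _ _)) (fun n => ?_)
      ((summable_geometric_of_lt_one (by positivity) hδρ).mul_left (1 + D / ρ))
    rw [mul_pow]
    calc _ ≤ δ ^ n * ((1 + D / ρ) * ρ ^ n) := by gcongr; exact htv n
      _ = _ := by ring
  refine ⟨hsum, ?_⟩
  rw [isLittleO_iff_tendsto fun n hn => absurd hn (by positivity)]
  refine hsum.tendsto_atTop_zero.congr fun n => ?_
  rw [div_inv_eq_mul, mul_comm]
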